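/- For integers $n,m\ge 1$ let $$\Delta_{n-1}\times\Delta_{m-1}=\Bigl\{(x,y)\in\mathbb{R}_{\ge 0}^{n}\times\mathbb{R}_{\ge 0}^{m} : \sum_{i} x_i=\sum_{j} y_j=1\Bigr\},$$ the polytope whose vertices $(e_i,e_j)$ are indexed by the edges of the complete bipartite graph $K_{n,m}$. The *chamber complex* of a finite point configuration is the common refinement of all its triangulations: its cells are the nonempty intersections obtained by choosing one simplex (of any dimension) from each triangulation. The chamber complex of $\Delta_{n-1}\times\Delta_{m-1}$ is that of its set of vertices. A *diagonal section* of a polytope $P$ is a hyperplane of the affine hull of $P$ that is spanned by vertices of $P$ but is not the affine hull of a facet of $P$. The *diagonal section complex* of $P$ is the subdivision of $P$ cut out by all its diagonal sections: its cells are the nonempty intersections of a face of $P$ with, for each diagonal section $H$, either $H$ or one of the two closed sides of $H$. Write $\Omega_{n,m}$ for the diagonal section complex of $\Delta_{n-1}\times\Delta_{m-1}$. The *Gale transform* of vectors $v_1,\dots,v_N$ consists of the $N$ coordinate functionals on the space $\{c\in\mathbb{R}^N:\sum_i c_iv_i=0\}$. A triangulation of a vector configuration $(w_i)$ is a simplicial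 fan with cones generated by subsets of the $w_i$ that covers the cone generated by all $w_i$; it is *regular* if there are heights $h_i$ such that for each maximal cone there is a linear functional $\varphi$ with $\varphi(w_i)=h_i$ for the generators $w_i$ of that cone and $\varphi(w_i)<h_i$ for all other $i$. A *virtual chamber* of $(v_i)$ is a family of bases whose complements are the maximal cones of a non-regular triangulation of the Gale transform of $(v_i)$. **Proposition.** 1. For all $n,m\ge 1$, the chamber complex of $\Delta_{n-1}\times\Delta_{m-1}$ coincides with the diagonal section complex $\Omega_{n,m}$. Moreover, the diagonal sections of $\Delta_{n-1}\times\Delta_{m-1}$ are exactly the affine spans of the sets $\{(e_i,e_j):\{i,j\}\text{ an edge of }F\}$, where $F$ runs over the spanning forests of $K_{n,m}$ that have exactly two components, neither of which is an isolated vertex. 2. For all $n,m\ge 2$ with $n+m\ge 7$, the vertex configuration $\{(e_i,e_j)\}\subset\mathbb{R}^{n+m}$ of $\Delta_{n-1}\times\Delta_{m-1}$ has a virtual chamber. -/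

import Mathlib

open Set

section Points

variable {ι E : Type*} [Fintype ι] [DecidableEq ι] [AddCommGroup E] [Module ℝ E]

/-- `T` is (the face poset of) a triangulation of the finite point configuration `v`: a simplicial
complex whose simplices are spanned by affinely independent points of `v`, meet along common faces,
and cover the convex hull of all the points. -/
structure IsPointTriangulation (v : ι → E) (T : Set (Finset ι)) : Prop where
  indep : ∀ σ ∈ T, AffineIndependent ℝ (fun i : σ => v i)
  down : ∀ σ ∈ T, ∀ τ ⊆ σ, τ ∈ T
  inter : ∀ σ ∈ T, ∀ τ ∈ T,
    convexHull ℝ (v '' σ) ∩ convexHull ℝ (v '' τ) = convexHull ℝ (v '' (σ ∩ τ : Finset ι))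
  cover : (⋃ σ ∈ T, convexHull ℝ (v '' σ)) = convexHull ℝ (range v)

/-- The chamber complex of a point configuration, given by its (nonempty, closed) cells: the common
refinement of all triangulations.  A cell is a nonempty set obtained by choosing one simplex
from every triangulation and intersecting the chosen simplices. -/
def chamberComplex (v : ι → E) : Set (Set E) :=
  {C | C.Nonempty ∧ ∃ f : {T : Set (Finset ι) // IsPointTriangulation v T} → Finset ι,
    (∀ T, f T ∈ T.1) ∧ C = ⋂ T, convexHull ℝ (v '' (f T : Set ι))}

variable [TopologicalSpace E]

/-- `F` is a facet of the polytope `P`: a face of codimension one. -/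
def IsPolytopeFacet (P F : Set E) : Prop :=
  F.Nonempty ∧ IsExposed ℝ P F ∧
    Module.finrank ℝ (vectorSpan ℝ F) + 1 = Module.finrank ℝ (vectorSpan ℝ P)

/-- `H` is a diagonal section of the polytope with vertices `v`: a hyperplane (in the affine hull
of the polytope) which is spanned by vertices but is not the affine hull of a facet. -/
def IsDiagonalSection (v : ι → E) (H : AffineSubspace ℝ E) : Prop :=
  (∃ S : Set ι, S.Nonempty ∧ H = affineSpan ℝ (v '' S)) ∧
  Module.finrank ℝ H.direction + 1 = Module.finrank ℝ (vectorSpan ℝ (range v)) ∧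
  ∀ F, IsPolytopeFacet (convexHull ℝ (range v)) F → H ≠ affineSpan ℝ F

/-- `D` is one of the three pieces into which the hyperplane `H` cuts the polytope `P`: the
hyperplane itself, or the closed side of it that contains some point `p` of `P` outside `H`.
(The pieces are only used after intersecting them with subsets of `P`.) -/
def IsHyperplanePiece (P : Set E) (H : AffineSubspace ℝ E) (D : Set E) : Prop :=
  D = (H : Set E) ∨ ∃ p ∈ P, p ∉ H ∧ D = {q | H.WSameSide p q}

/-- The diagonal section complex of the polytope with vertices `v`, given by its (nonempty, closed)
cells: the subdivision cut out by all diagonal sections.  A cell is a nonempty intersection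
of a face of the polytope with one piece for each diagonal section. -/
def diagonalSectionComplex (v : ι → E) : Set (Set E) :=
  {C | C.Nonempty ∧ ∃ F, IsExposed ℝ (convexHull ℝ (range v)) F ∧
    ∃ s : {H : AffineSubspace ℝ E // IsDiagonalSection v H} → Set E,
      (∀ H, IsHyperplanePiece (convexHull ℝ (range v)) H.1 (s H)) ∧ C = F ∩ ⋂ H, s H}

end Points

section Vectors

variable {ι V : Type*} [Fintype ι] [DecidableEq ι] [AddCommGroup V] [Module ℝ V]

/-- The cone of nonnegative combinations of the vectors `w i` with `i ∈ σ`. -/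
def coneOf (w : ι → V) (σ : Finset ι) : Set V :=
  {x | ∃ c : ι → ℝ, (∀ i, 0 ≤ c i) ∧ x = ∑ i ∈ σ, c i • w i}

/-- `T` is (the face poset of) a triangulation of the finite vector configuration `w`: a simplicial
fan whose cones are spanned by linearly independent vectors of `w`, meet along common faces,
and cover the cone spanned by all the vectors. -/
structure IsVectorTriangulation (w : ι → V) (T : Set (Finset ι)) : Prop where
  indep : ∀ σ ∈ T, LinearIndependent ℝ (fun i : σ => w i)
  down : ∀ σ ∈ T, ∀ τ ⊆ σ, τ ∈ T
  inter : ∀ σ ∈ T, ∀ τ ∈ T, coneOf w σ ∩ coneOf w τ = coneOf w (σ ∩ τ)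
  cover : (⋃ σ ∈ T, coneOf w σ) = coneOf w Finset.univ

/-- A triangulation `T` of `w` is regular if it is induced by some heights `h`: over every maximal
cone of `T` there is a linear functional that agrees with the heights on the generators of
that cone and lies strictly below the heights on all other vectors. -/
def IsRegularTriangulation (w : ι → V) (T : Set (Finset ι)) : Prop :=
  ∃ h : ι → ℝ, ∀ σ, Maximal (· ∈ T) σ →
    ∃ φ : Module.Dual ℝ V, (∀ i ∈ σ, φ (w i) = h i) ∧ ∀ i ∉ σ, φ (w i) < h i

/-- The Gale transform of a vector configuration `v`: the `i`-th vector is the `i`-th coordinate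
functional on the space `{c | ∑ i, c i • v i = 0}` of linear dependences.  (In coordinates
given by a basis of that space, these are the columns of the matrix whose rows are the basis.) -/
def galeTransform (v : ι → V) :
    ι → Module.Dual ℝ (LinearMap.ker (Fintype.linearCombination ℝ v)) :=
  fun i => (LinearMap.proj i : (ι → ℝ) →ₗ[ℝ] ℝ) ∘ₗ
    (LinearMap.ker (Fintype.linearCombination ℝ v)).subtype

/-- A virtual chamber of the vector configuration `v`: a family `C` of bases of `v` whose complements
are the maximal cones of a non-regular triangulation of the Gale transform of `v`.
(The complements of the bases that contain an actual chamber form a regular one.) -/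
def IsVirtualChamber (v : ι → V) (C : Set (Finset ι)) : Prop :=
  ∃ T, IsVectorTriangulation (galeTransform v) T ∧
    ¬ IsRegularTriangulation (galeTransform v) T ∧
    C = {τ | Maximal (· ∈ T) τᶜ}

end Vectors

/-- The vertices `(e_i, e_j)` of the product of simplices `Δ_{n-1} × Δ_{m-1}`; equivalently, the
columns of the vertex-edge incidence matrix of the complete bipartite graph `K_{n,m}`. -/
def productVertex (n m : ℕ) (p : Fin n × Fin m) : (Fin n → ℝ) × (Fin m → ℝ) :=
  (Pi.single p.1 1, Pi.single p.2 1)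

theorem convexHull_range_productVertex (n m : ℕ) :
    convexHull ℝ (range (productVertex n m)) = stdSimplex ℝ (Fin n) ×ˢ stdSimplex ℝ (Fin m) := by
  rw [← convexHull_rangle_single_eq_stdSimplex, ← convexHull_rangle_single_eq_stdSimplex,
    ← convexHull_prod, Set.range_prodMap.symm]
  rfl

/-- `F` is a spanning forest of `K_{n,m}` with exactly two components, both of which have at least
one edge (that is, `F` has no isolated vertex). -/
def IsTwoComponentForest {n m : ℕ} (F : SimpleGraph (Fin n ⊕ Fin m)) : Prop :=
  F ≤ completeBipartiteGraph (Fin n) (Fin m) ∧ F.IsAcyclic ∧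
    Nat.card F.ConnectedComponent = 2 ∧ ∀ a, ∃ b, F.Adj a b

/-- The affine span of the vertices of `Δ_{n-1} × Δ_{m-1}` that correspond to the edges of `F`. -/
def edgeSpan {n m : ℕ} (F : SimpleGraph (Fin n ⊕ Fin m)) :
    AffineSubspace ℝ ((Fin n → ℝ) × (Fin m → ℝ)) :=
  affineSpan ℝ (productVertex n m '' {p | F.Adj (Sum.inl p.1) (Sum.inr p.2)})

/-!
Both parts rest on the matrix picture: a vector indexed by the vertices `(e_i, e_j)` is an `n × m`
matrix, its image in `ℝⁿ × ℝᵐ` is the pair of its row and column sums, and two matrices agree on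
the Gale transform exactly when they differ by potentials `a i + b j`.

**Chambers and diagonal sections.** Put `g_{A,B}(x, y) = x(A) - y(B)` for sets `A` of rows and `B`
of columns (`cutForm`). On vertices these cuts take the values `-1, 0, 1`. A linear functional
that vanishes on a set of vertices has level sets that are unions of components of the
corresponding graph, so it is a combination of cuts vanishing on this set
(`exists_cutForm_ne_zero`). Consequently every simplex spanned by vertices is cut out of the
polytope by cuts (`mem_convexHull_image_of_cutForm_nonneg`). Conversely no cut is crossed by all
triangulations: the staircase triangulation for orderings that start with `A` and `B` has every
simplex on one side of `g_{A,B}` (`exists_triangulation_one_sided`). That the chains of a product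
order form a triangulation means that every pair of marginals has exactly one coupling supported
on a chain: it exists because a coupling maximizing `∑ r i * s j * c (i, j)` has no crossing, and
it is unique because its corner sums are minima of marginal sums. So the chamber complex is the
subdivision by all cuts (`chamberComplex_productVertex`). A hyperplane spanned by vertices is the
zero set of a cut. If `A` and `B` are both proper and nonempty this is a diagonal section;
otherwise the polytope is on one side and the hyperplane, if spanned by vertices, is that of a
facet. Hence the diagonal section complex is the same subdivision
(`diagonalSectionComplex_productVertex`). The two components of a two-component forest are `A ∪ B`
and its complement for a proper cut `(A, B)`, and conversely a spanning forest of the graph with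
these two complete bipartite parts spans the cut.

**Virtual chambers.** For two rows and four columns, the Gale transform consists of `± e_j` in `ℝ⁴
/ (1, 1, 1, 1)`, and every nonconstant monotone Boolean function in four variables gives a
triangulation: a point `t` lies in a cone determined by the threshold `s` at which `{j | t j ≤ s}`
becomes a one of the function. The triangulation is regular only if the function is a threshold
function, and `x₀ x₁ ∨ x₂ x₃` is not one. Further rows and columns are added by joins with
boundaries of simplices, which amounts to normalizing the minimum of a row or column to zero. The
result is `crossedFamily`. It is a triangulation because each matrix can be changed by potentials
in exactly one way into a nonnegative matrix with support in the family, and it is not regular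
because four of the height inequalities add up to a contradiction.
-/

/-! ### Triangulations and unique representations -/

section VectorTriangulations

variable {ι V : Type*} [Fintype ι] [DecidableEq ι] [AddCommGroup V] [Module ℝ V]

theorem mem_coneOf_iff_exists_support {w : ι → V} {σ : Finset ι} {x : V} :
    x ∈ coneOf w σ ↔
      ∃ c : ι → ℝ, (∀ i, 0 ≤ c i) ∧ (∀ i ∉ σ, c i = 0) ∧ ∑ i, c i • w i = x := by
  constructor
  · rintro ⟨c, hc, rfl⟩
    refine ⟨fun i => if i ∈ σ then c i else 0, fun i => ?_, fun i hi => by simp [hi], ?_⟩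
    · dsimp only
      split_ifs
      exacts [hc i, le_rfl]
    · simp [ite_smul, Finset.sum_ite_mem]
  · rintro ⟨c, hc, h0, rfl⟩
    refine ⟨c, hc, (Finset.sum_subset (Finset.subset_univ σ) fun i _ hi => ?_).symm⟩
    rw [h0 i hi, zero_smul]

theorem linearIndependent_of_unique_representation {w : ι → V} {σ : Finset ι}
    (uniq : ∀ c d : ι → ℝ, (∀ i, 0 ≤ c i) → (∀ i, 0 ≤ d i) → (∀ i ∉ σ, c i = 0) →
      (∀ i ∉ σ, d i = 0) → ∑ i, c i • w i = ∑ i, d i • w i → c = d) :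
    LinearIndependent ℝ fun i : σ => w i := by
  rw [Fintype.linearIndependent_iff]
  intro g hg
  let c : ι → ℝ := fun i => if h : i ∈ σ then g ⟨i, h⟩ else 0
  have hc : ∑ i, c i • w i = 0 := by
    rw [← hg, ← Finset.sum_subset (Finset.subset_univ σ)]
    · rw [← Finset.sum_coe_sort σ]
      exact Finset.sum_congr rfl fun i _ => by simp [c]
    · intro i _ hi
      simp [c, hi]
  -- The positive and the negative part of a linear dependence represent the same vector.
  have key := uniq (fun i => max (c i) 0) (fun i => max (-c i) 0) (fun i => le_max_right _ _)
    (fun i => le_max_right _ _) (fun i hi => by simp [c, hi])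
    (fun i hi => by simp [c, hi]) (by
      rw [← sub_eq_zero, ← Finset.sum_sub_distrib, ← hc]
      refine Finset.sum_congr rfl fun i _ => ?_
      rw [← sub_smul]
      congr 1
      rcases le_total (c i) 0 with h | h
      · rw [max_eq_right h, max_eq_left (by linarith)]; ring
      · rw [max_eq_left h, max_eq_right (by linarith)]; ring)
  intro i
  have h := congrFun key i
  have hci : c i = g i := by simp [c]
  rw [hci] at h
  rcases le_total (g i) 0 with h' | h'
  · rw [max_eq_right h', max_eq_left (by linarith)] at h; linarith
  · rw [max_eq_left h', max_eq_right (by linarith)] at h; linarith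

/-- A down-closed family is a triangulation as soon as every vector of the cone has exactly one
nonnegative representation whose support belongs to the family. -/
theorem IsVectorTriangulation.of_unique_representation {w : ι → V} {T : Set (Finset ι)}
    (down : ∀ σ ∈ T, ∀ τ ⊆ σ, τ ∈ T)
    (ex : ∀ c : ι → ℝ, (∀ i, 0 ≤ c i) → ∃ d : ι → ℝ, (∀ i, 0 ≤ d i) ∧
      Finset.univ.filter (d · ≠ 0) ∈ T ∧ ∑ i, d i • w i = ∑ i, c i • w i)
    (uniq : ∀ c d : ι → ℝ, (∀ i, 0 ≤ c i) → (∀ i, 0 ≤ d i) →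
      Finset.univ.filter (c · ≠ 0) ∈ T → Finset.univ.filter (d · ≠ 0) ∈ T →
      ∑ i, c i • w i = ∑ i, d i • w i → c = d) :
    IsVectorTriangulation w T := by
  have supp : ∀ σ ∈ T, ∀ c : ι → ℝ, (∀ i ∉ σ, c i = 0) → Finset.univ.filter (c · ≠ 0) ∈ T := by
    intro σ hσ c hc
    refine down σ hσ _ fun i hi => ?_
    by_contra h
    exact (Finset.mem_filter.1 hi).2 (hc i h)
  refine ⟨fun σ hσ => ?_, down, fun σ hσ τ hτ => ?_, ?_⟩
  · exact linearIndependent_of_unique_representation fun c d hc hd hcσ hdσ =>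
      uniq c d hc hd (supp σ hσ c hcσ) (supp σ hσ d hdσ)
  · ext x
    constructor
    · rintro ⟨h1, h2⟩
      obtain ⟨c, hc, hcσ, rfl⟩ := mem_coneOf_iff_exists_support.1 h1
      obtain ⟨d, hd, hdτ, h⟩ := mem_coneOf_iff_exists_support.1 h2
      obtain rfl := uniq d c hd hc (supp τ hτ d hdτ) (supp σ hσ c hcσ) h
      refine mem_coneOf_iff_exists_support.2 ⟨d, hd, fun i hi => ?_, rfl⟩
      by_cases his : i ∈ σ
      · exact hdτ i fun hit => hi (Finset.mem_inter.2 ⟨his, hit⟩)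
      · exact hcσ i his
    · intro h
      obtain ⟨c, hc, h0, rfl⟩ := mem_coneOf_iff_exists_support.1 h
      exact ⟨mem_coneOf_iff_exists_support.2
          ⟨c, hc, fun i hi => h0 i fun h => hi (Finset.mem_inter.1 h).1, rfl⟩,
        mem_coneOf_iff_exists_support.2
          ⟨c, hc, fun i hi => h0 i fun h => hi (Finset.mem_inter.1 h).2, rfl⟩⟩
  · ext x
    simp only [mem_iUnion, exists_prop]
    constructor
    · rintro ⟨σ, -, h⟩
      obtain ⟨c, hc, -, rfl⟩ := mem_coneOf_iff_exists_support.1 h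
      exact ⟨c, hc, rfl⟩
    · rintro ⟨c, hc, rfl⟩
      obtain ⟨d, hd, hT, h⟩ := ex c hc
      refine ⟨_, hT, mem_coneOf_iff_exists_support.2 ⟨d, hd, fun i hi => ?_, h⟩⟩
      by_contra h'
      exact hi (Finset.mem_filter.2 ⟨Finset.mem_univ i, h'⟩)

/-- The height function of a regular triangulation prefers faces: among two families of generators
with the same sum, one that spans a cone of the triangulation has a smaller total height
than one that does not. -/
theorem sum_height_lt_of_regular {w : ι → V} {T : Set (Finset ι)}
    (down : ∀ σ ∈ T, ∀ τ ⊆ σ, τ ∈ T) {h : ι → ℝ}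
    (hreg : ∀ σ, Maximal (· ∈ T) σ →
      ∃ φ : Module.Dual ℝ V, (∀ i ∈ σ, φ (w i) = h i) ∧ ∀ i ∉ σ, φ (w i) < h i)
    {S S' : Finset ι} (hS : S ∈ T) (hS' : S' ∉ T) (hsum : ∑ i ∈ S, w i = ∑ i ∈ S', w i) :
    ∑ i ∈ S, h i < ∑ i ∈ S', h i := by
  obtain ⟨σ, hSσ, hσ⟩ := (toFinite T).exists_le_maximal hS
  obtain ⟨φ, h1, h2⟩ := hreg σ hσ
  have hnot : ¬ S' ⊆ σ := fun hsub => hS' (down σ hσ.prop _ hsub)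
  obtain ⟨p, hp, hpσ⟩ := Finset.not_subset.1 hnot
  calc ∑ i ∈ S, h i = φ (∑ i ∈ S, w i) := by
        rw [map_sum]
        exact Finset.sum_congr rfl fun i hi => (h1 i (hSσ hi)).symm
    _ = ∑ i ∈ S', φ (w i) := by rw [hsum, map_sum]
    _ < ∑ i ∈ S', h i := by
        refine Finset.sum_lt_sum (fun i _ => ?_) ⟨p, hp, h2 p hpσ⟩
        by_cases hi : i ∈ σ
        · exact (h1 i hi).le
        · exact (h2 i hi).le

end VectorTriangulations

/-! ### A non-regular triangulation from a non-threshold Boolean function -/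

section CrossedFamily

variable {α β ι : Type*}

/-- The family of index sets behind the virtual chamber. The indices `ι` are identified with the
cells of a matrix, `p₀` and `p₁` are two rows and `q` lists four columns. On these two rows and four
columns the conditions encode the monotone Boolean function `x₀ x₁ ∨ x₂ x₃`, which is not a threshold
function: the cells of row `p₁` in a member sit over columns forming a zero of the function, and the
columns not hit in row `p₀` form a one. The last two conditions are joins with boundaries of simplices,
for the remaining rows and columns. -/
def crossedFamily (e : α × β ≃ ι) (p₀ p₁ : α) (q : Fin 4 → β) : Set (Finset ι) :=
  {σ | (∀ k, e (p₀, q k) ∉ σ ∨ e (p₁, q k) ∉ σ) ∧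
    (e (p₁, q 0) ∉ σ ∨ e (p₁, q 1) ∉ σ) ∧ (e (p₁, q 2) ∉ σ ∨ e (p₁, q 3) ∉ σ) ∧
    ((e (p₀, q 0) ∉ σ ∧ e (p₀, q 1) ∉ σ) ∨ (e (p₀, q 2) ∉ σ ∧ e (p₀, q 3) ∉ σ)) ∧
    (∀ i, ∃ k, e (i, q k) ∉ σ) ∧ ∀ j, ∃ i, e (i, j) ∉ σ}

theorem crossedFamily_down (e : α × β ≃ ι) (p₀ p₁ : α) (q : Fin 4 → β) :
    ∀ σ ∈ crossedFamily e p₀ p₁ q, ∀ τ ⊆ σ, τ ∈ crossedFamily e p₀ p₁ q := by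
  rintro σ ⟨h1, h2, h3, h4, h5, h6⟩ τ hτ
  have key : ∀ x, x ∉ σ → x ∉ τ := fun x hx hxτ => hx (hτ hxτ)
  exact ⟨fun k => (h1 k).imp (key _) (key _), h2.imp (key _) (key _), h3.imp (key _) (key _),
    h4.imp (And.imp (key _) (key _)) (And.imp (key _) (key _)),
    fun i => (h5 i).imp fun _ => key _, fun j => (h6 j).imp fun _ => key _⟩

/-- Two nonnegative matrices with supports in the crossed family that differ by row and column
potentials are equal. -/
theorem crossedFamily_unique [Fintype ι] (e : α × β ≃ ι) {p₀ p₁ : α} {q : Fin 4 → β} {c d : ι → ℝ}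
    (hc : ∀ x, 0 ≤ c x) (hd : ∀ x, 0 ≤ d x)
    (hcT : Finset.univ.filter (c · ≠ 0) ∈ crossedFamily e p₀ p₁ q)
    (hdT : Finset.univ.filter (d · ≠ 0) ∈ crossedFamily e p₀ p₁ q)
    {a : α → ℝ} {b : β → ℝ} (h : ∀ i j, c (e (i, j)) - d (e (i, j)) = a i + b j) : c = d := by
  simp only [crossedFamily, Set.mem_ofPred_eq, Finset.mem_filter, Finset.mem_univ, true_and,
    not_not] at hcT hdT
  obtain ⟨c1, c2, c3, c4, c5, c6⟩ := hcT
  obtain ⟨d1, d2, d3, d4, d5, d6⟩ := hdT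
  have C0 := fun k => hc (e (p₀, q k))
  have C1 := fun k => hc (e (p₁, q k))
  have D0 := fun k => hd (e (p₀, q k))
  have D1 := fun k => hd (e (p₁, q k))
  have H0 := fun k => h p₀ (q k)
  have H1 := fun k => h p₁ (q k)
  -- The two rows `p₀` and `p₁` determine the difference of their potentials.
  have hs : a p₀ = a p₁ := by
    rcases lt_trichotomy (a p₀) (a p₁) with hlt | heq | hlt
    · exfalso
      rcases d4 with ⟨x, y⟩ | ⟨x, y⟩
      · rcases c2 with z | z
        · linarith [C0 0, D1 0, H0 0, H1 0]
        · linarith [C0 1, D1 1, H0 1, H1 1]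
      · rcases c3 with z | z
        · linarith [C0 2, D1 2, H0 2, H1 2]
        · linarith [C0 3, D1 3, H0 3, H1 3]
    · exact heq
    · exfalso
      rcases c4 with ⟨x, y⟩ | ⟨x, y⟩
      · rcases d2 with z | z
        · linarith [D0 0, C1 0, H0 0, H1 0]
        · linarith [D0 1, C1 1, H0 1, H1 1]
      · rcases d3 with z | z
        · linarith [D0 2, C1 2, H0 2, H1 2]
        · linarith [D0 3, C1 3, H0 3, H1 3]
  have hq : ∀ k, b (q k) = - a p₀ := by
    intro k
    have h0 := H0 k
    have h1 := H1 k
    rcases c1 k with x | x <;> rcases d1 k with y | y <;>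
      linarith [C0 k, C1 k, D0 k, D1 k]
  have hrow : ∀ i, a i = a p₀ := by
    intro i
    obtain ⟨k, hk⟩ := c5 i
    obtain ⟨l, hl⟩ := d5 i
    linarith [h i (q k), h i (q l), hd (e (i, q k)), hc (e (i, q l)), hq k, hq l]
  have hcol : ∀ j, b j = - a p₀ := by
    intro j
    obtain ⟨k, hk⟩ := c6 j
    obtain ⟨l, hl⟩ := d6 j
    linarith [h k j, h l j, hd (e (k, j)), hc (e (l, j)), hrow k, hrow l]
  funext x
  obtain ⟨⟨i, j⟩, rfl⟩ := e.surjective x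
  linarith [h i j, hrow i, hcol j]

/-- Every matrix can be made nonnegative with support in the crossed family by subtracting row and
column potentials. -/
theorem crossedFamily_exists [Fintype α] [Fintype ι] (e : α × β ≃ ι) (p₀ p₁ : α)
    (q : Fin 4 → β) (c : ι → ℝ) :
    ∃ (d : ι → ℝ) (a : α → ℝ) (b : β → ℝ), (∀ x, 0 ≤ d x) ∧
      Finset.univ.filter (d · ≠ 0) ∈ crossedFamily e p₀ p₁ q ∧
      ∀ i j, d (e (i, j)) - c (e (i, j)) = a i + b j := by
  have : Nonempty α := ⟨p₀⟩
  let M : α → β → ℝ := fun i j => c (e (i, j))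
  let t : Fin 4 → ℝ := fun k => M p₀ (q k) - M p₁ (q k)
  -- `s` is the threshold at which `{k | t k ≤ s}` becomes a one of `x₀ x₁ ∨ x₂ x₃`.
  obtain ⟨s, hs⟩ : ∃ s, s = min (max (t 0) (t 1)) (max (t 2) (t 3)) := ⟨_, rfl⟩
  have s1 : s ≤ t 0 ∨ s ≤ t 1 := by
    rw [← le_max_iff, hs]; exact min_le_left _ _
  have s2 : s ≤ t 2 ∨ s ≤ t 3 := by
    rw [← le_max_iff, hs]; exact min_le_right _ _
  have s3 : (t 0 ≤ s ∧ t 1 ≤ s) ∨ (t 2 ≤ s ∧ t 3 ≤ s) := by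
    rw [← max_le_iff, ← max_le_iff, hs]
    exact (min_choice _ _).imp (fun h => h.ge) (fun h => h.ge)
  let b₀ : Fin 4 → ℝ := fun k => min (M p₀ (q k) - s) (M p₁ (q k))
  obtain ⟨a, ha⟩ : ∃ a : α → ℝ, ∀ i, (∀ k, a i ≤ M i (q k) - b₀ k) ∧
      ∃ k, a i = M i (q k) - b₀ k := by
    refine ⟨fun i => Finset.univ.inf' Finset.univ_nonempty fun k => M i (q k) - b₀ k,
      fun i => ⟨fun k => Finset.inf'_le _ (Finset.mem_univ k), ?_⟩⟩
    obtain ⟨k, -, hk⟩ := Finset.exists_mem_eq_inf' Finset.univ_nonempty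
      fun k => M i (q k) - b₀ k
    exact ⟨k, hk⟩
  obtain ⟨b, hb⟩ : ∃ b : β → ℝ, ∀ j, (∀ i, b j ≤ M i j - a i) ∧ ∃ i, b j = M i j - a i := by
    refine ⟨fun j => Finset.univ.inf' Finset.univ_nonempty fun i => M i j - a i,
      fun j => ⟨fun i => Finset.inf'_le _ (Finset.mem_univ i), ?_⟩⟩
    obtain ⟨i, -, hi⟩ := Finset.exists_mem_eq_inf' Finset.univ_nonempty fun i => M i j - a i
    exact ⟨i, hi⟩
  have b0l : ∀ k, b₀ k ≤ M p₀ (q k) - s := fun k => min_le_left _ _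
  have b0r : ∀ k, b₀ k ≤ M p₁ (q k) := fun k => min_le_right _ _
  have ts : ∀ k, t k ≤ s → b₀ k = M p₀ (q k) - s := fun k hk =>
    min_eq_left (by simp only [t] at hk; linarith)
  have st : ∀ k, s ≤ t k → b₀ k = M p₁ (q k) := fun k hk =>
    min_eq_right (by simp only [t] at hk; linarith)
  have ha0 : a p₀ = s := by
    apply le_antisymm
    · rcases s3 with ⟨x, -⟩ | ⟨x, -⟩
      · linarith [(ha p₀).1 0, ts 0 x]
      · linarith [(ha p₀).1 2, ts 2 x]
    · obtain ⟨k, hk⟩ := (ha p₀).2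
      linarith [b0l k]
  have ha1 : a p₁ = 0 := by
    apply le_antisymm
    · rcases s1 with x | x
      · linarith [(ha p₁).1 0, st 0 x]
      · linarith [(ha p₁).1 1, st 1 x]
    · obtain ⟨k, hk⟩ := (ha p₁).2
      linarith [b0r k]
  have hbq : ∀ k, b (q k) = b₀ k := by
    intro k
    apply le_antisymm
    · refine le_min ?_ ?_
      · linarith [(hb (q k)).1 p₀]
      · linarith [(hb (q k)).1 p₁]
    · obtain ⟨i, hi⟩ := (hb (q k)).2
      linarith [(ha i).1 k]
  refine ⟨fun x => c x - a (e.symm x).1 - b (e.symm x).2, fun i => - a i, fun j => - b j,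
    fun x => ?_, ?_, fun i j => ?_⟩
  · obtain ⟨⟨i, j⟩, rfl⟩ := e.surjective x
    simp only [Equiv.symm_apply_apply]
    linarith [(hb j).1 i]
  · simp only [crossedFamily, Set.mem_ofPred_eq, Finset.mem_filter, Finset.mem_univ, true_and,
      not_not, Equiv.symm_apply_apply, ha0, ha1, hbq]
    refine ⟨fun k => ?_, ?_, ?_, ?_, fun i => ?_, fun j => ?_⟩
    · rcases le_total (t k) s with h | h
      · left; linarith [ts k h]
      · right; linarith [st k h]
    · refine s1.imp (fun h => ?_) fun h => ?_
      · linarith [st 0 h]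
      · linarith [st 1 h]
    · refine s2.imp (fun h => ?_) fun h => ?_
      · linarith [st 2 h]
      · linarith [st 3 h]
    · refine s3.imp (fun h => ⟨?_, ?_⟩) fun h => ⟨?_, ?_⟩
      · linarith [ts 0 h.1]
      · linarith [ts 1 h.2]
      · linarith [ts 2 h.1]
      · linarith [ts 3 h.2]
    · obtain ⟨k, hk⟩ := (ha i).2
      exact ⟨k, by linarith [hbq k]⟩
    · obtain ⟨i, hi⟩ := (hb j).2
      exact ⟨i, by linarith⟩
  · simp only [Equiv.symm_apply_apply]
    ring

theorem isVectorTriangulation_crossedFamily [Fintype α] [Fintype ι] [DecidableEq ι]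
    {V : Type*} [AddCommGroup V] [Module ℝ V] (e : α × β ≃ ι) (p₀ p₁ : α) (q : Fin 4 → β)
    {w : ι → V} (hw : ∀ c : ι → ℝ, ∑ x, c x • w x = 0 ↔
      ∃ (a : α → ℝ) (b : β → ℝ), ∀ i j, c (e (i, j)) = a i + b j) :
    IsVectorTriangulation w (crossedFamily e p₀ p₁ q) := by
  have hw' : ∀ c d : ι → ℝ, ∑ x, c x • w x = ∑ x, d x • w x ↔
      ∃ (a : α → ℝ) (b : β → ℝ), ∀ i j, c (e (i, j)) - d (e (i, j)) = a i + b j := by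
    intro c d
    rw [← sub_eq_zero, ← Finset.sum_sub_distrib, ← hw fun x => c x - d x]
    simp only [sub_smul]
  refine .of_unique_representation (crossedFamily_down e p₀ p₁ q) (fun c _ => ?_)
    fun c d hc hd hcT hdT h => ?_
  · obtain ⟨d, a, b, hd, hdT, h⟩ := crossedFamily_exists e p₀ p₁ q c
    exact ⟨d, hd, hdT, (hw' d c).2 ⟨a, b, h⟩⟩
  · obtain ⟨a, b, h⟩ := (hw' c d).1 h
    exact crossedFamily_unique e hc hd hcT hdT h

/-- Two cells of a row `p` have the same sum in the Gale transform as all cells outside this row and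
outside the columns of the two cells, by the potential that is `1` on row `p` and `-1` on the other
columns. -/
theorem sum_pair_eq_sum_filter [DecidableEq α] [DecidableEq β] [Fintype ι] [DecidableEq ι]
    {V : Type*} [AddCommGroup V] [Module ℝ V] (e : α × β ≃ ι) {w : ι → V}
    (hw : ∀ c : ι → ℝ, ∑ x, c x • w x = 0 ↔
      ∃ (a : α → ℝ) (b : β → ℝ), ∀ i j, c (e (i, j)) = a i + b j) (p : α) (x y : β) :
    ∑ z ∈ {e (p, x), e (p, y)}, w z =
      ∑ z with (e.symm z).1 ≠ p ∧ (e.symm z).2 ≠ x ∧ (e.symm z).2 ≠ y, w z := by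
  have h1 : ∑ z ∈ {e (p, x), e (p, y)}, w z =
      ∑ z, (if z ∈ ({e (p, x), e (p, y)} : Finset ι) then (1 : ℝ) else 0) • w z := by
    simp only [ite_smul, one_smul, zero_smul, Finset.sum_ite_mem, Finset.univ_inter]
  have h2 : ∑ z with (e.symm z).1 ≠ p ∧ (e.symm z).2 ≠ x ∧ (e.symm z).2 ≠ y, w z =
      ∑ z, (if (e.symm z).1 ≠ p ∧ (e.symm z).2 ≠ x ∧ (e.symm z).2 ≠ y
        then (1 : ℝ) else 0) • w z := by
    rw [Finset.sum_filter]
    exact Finset.sum_congr rfl fun z _ => by split_ifs <;> simp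
  rw [h1, h2, ← sub_eq_zero, ← Finset.sum_sub_distrib]
  simp only [← sub_smul]
  refine (hw _).2 ⟨fun i => if i = p then 1 else 0, fun j => if j ≠ x ∧ j ≠ y then -1 else 0,
    fun i j => ?_⟩
  simp only [Finset.mem_insert, Finset.mem_singleton, EmbeddingLike.apply_eq_iff_eq,
    Prod.mk.injEq, Equiv.symm_apply_apply]
  by_cases hi : i = p <;> by_cases hx : j = x <;> by_cases hy : j = y <;> simp [hi, hx, hy]

/-- Pair up the four cells of row `p₀`. The pairs `01` and `23` span cones of the crossed family while
their complementary families do not, and for the pairs `02` and `13` it is the other way round. The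
height inequalities for the first two pairs and for the last two pairs contradict each other. -/
theorem not_isRegularTriangulation_crossedFamily [Fintype ι] [DecidableEq ι]
    {V : Type*} [AddCommGroup V] [Module ℝ V] (e : α × β ≃ ι) {p₀ p₁ : α} (hp : p₀ ≠ p₁)
    {q : Fin 4 → β} (hq : Function.Injective q) {w : ι → V}
    (hw : ∀ c : ι → ℝ, ∑ x, c x • w x = 0 ↔
      ∃ (a : α → ℝ) (b : β → ℝ), ∀ i j, c (e (i, j)) = a i + b j) :
    ¬ IsRegularTriangulation w (crossedFamily e p₀ p₁ q) := by
  classical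
  rintro ⟨h, hreg⟩
  have hne : ∀ {k l : Fin 4}, k ≠ l → q k ≠ q l := fun hkl => hq.ne hkl
  let L : β → β → Finset ι := fun x y =>
    Finset.univ.filter fun z => (e.symm z).1 ≠ p₀ ∧ (e.symm z).2 ≠ x ∧ (e.symm z).2 ≠ y
  have memL : ∀ x y i j, e (i, j) ∈ L x y ↔ i ≠ p₀ ∧ j ≠ x ∧ j ≠ y := by
    intro x y i j
    simp [L]
  have memP : ∀ x y i j, e (i, j) ∈ ({e (p₀, x), e (p₀, y)} : Finset ι) ↔
      i = p₀ ∧ (j = x ∨ j = y) := by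
    intro x y i j
    simp only [Finset.mem_insert, Finset.mem_singleton, EmbeddingLike.apply_eq_iff_eq,
      Prod.mk.injEq]
    tauto
  have sumP : ∀ k l, k ≠ l → ∑ z ∈ ({e (p₀, q k), e (p₀, q l)} : Finset ι), h z =
      h (e (p₀, q k)) + h (e (p₀, q l)) := fun k l hkl =>
    Finset.sum_pair (by simpa using hne hkl)
  have down := crossedFamily_down e p₀ p₁ q
  have pairT : ∀ k l, (k = 0 ∧ l = 1) ∨ (k = 2 ∧ l = 3) →
      ({e (p₀, q k), e (p₀, q l)} : Finset ι) ∈ crossedFamily e p₀ p₁ q ∧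
      L (q k) (q l) ∉ crossedFamily e p₀ p₁ q := by
    intro k l hkl
    simp only [crossedFamily, Set.mem_ofPred_eq, memP, memL, hp.symm, hq.eq_iff]
    rcases hkl with ⟨rfl, rfl⟩ | ⟨rfl, rfl⟩
    · refine ⟨⟨by simp, by simp, by simp, by simp, fun i => ⟨2, by simp⟩, fun j => ⟨p₁, ?_⟩⟩, ?_⟩
      · simp [hp.symm]
      · rintro ⟨-, -, h, -⟩
        simp [hp.symm, hq.eq_iff] at h
    · refine ⟨⟨by simp, by simp, by simp, by simp, fun i => ⟨0, by simp⟩, fun j => ⟨p₁, ?_⟩⟩, ?_⟩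
      · simp [hp.symm]
      · rintro ⟨-, h, -⟩
        simp [hp.symm, hq.eq_iff] at h
  have coT : ∀ k l, (k = 0 ∧ l = 2) ∨ (k = 1 ∧ l = 3) →
      L (q k) (q l) ∈ crossedFamily e p₀ p₁ q ∧
      ({e (p₀, q k), e (p₀, q l)} : Finset ι) ∉ crossedFamily e p₀ p₁ q := by
    intro k l hkl
    simp only [crossedFamily, Set.mem_ofPred_eq, memP, memL, hp.symm, hq.eq_iff]
    rcases hkl with ⟨rfl, rfl⟩ | ⟨rfl, rfl⟩
    · refine ⟨⟨by simp, by simp, by simp, by simp, fun i => ⟨0, by simp⟩, fun j => ⟨p₀, by simp⟩⟩, ?_⟩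
      simp
    · refine ⟨⟨by simp, by simp, by simp, by simp, fun i => ⟨1, by simp⟩, fun j => ⟨p₀, by simp⟩⟩, ?_⟩
      simp
  have lt1 := sum_height_lt_of_regular down hreg (pairT 0 1 (by simp)).1 (pairT 0 1 (by simp)).2
    (sum_pair_eq_sum_filter e hw p₀ (q 0) (q 1))
  have lt2 := sum_height_lt_of_regular down hreg (pairT 2 3 (by simp)).1 (pairT 2 3 (by simp)).2
    (sum_pair_eq_sum_filter e hw p₀ (q 2) (q 3))
  have lt3 := sum_height_lt_of_regular down hreg (coT 0 2 (by simp)).1 (coT 0 2 (by simp)).2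
    (sum_pair_eq_sum_filter e hw p₀ (q 0) (q 2)).symm
  have lt4 := sum_height_lt_of_regular down hreg (coT 1 3 (by simp)).1 (coT 1 3 (by simp)).2
    (sum_pair_eq_sum_filter e hw p₀ (q 1) (q 3)).symm
  rw [sumP _ _ (by decide)] at lt1 lt2 lt3 lt4
  have hL : ∑ z ∈ L (q 0) (q 1), h z + ∑ z ∈ L (q 2) (q 3), h z =
      ∑ z ∈ L (q 0) (q 2), h z + ∑ z ∈ L (q 1) (q 3), h z := by
    simp only [L, Finset.sum_filter, ← Finset.sum_add_distrib]
    refine Finset.sum_congr rfl fun z _ => ?_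
    by_cases hz : ∃ k, (e.symm z).2 = q k
    · obtain ⟨k, hk⟩ := hz
      simp only [hk, ne_eq, hq.eq_iff]
      fin_cases k <;> simp
    · push Not at hz
      simp [hz]
  linarith

end CrossedFamily

/-! ### The Gale transform of the product of simplices -/

section Gale

theorem sum_smul_productVertex {n m : ℕ} (c : Fin n × Fin m → ℝ) :
    ∑ p, c p • productVertex n m p = (fun i => ∑ j, c (i, j), fun j => ∑ i, c (i, j)) := by
  rw [Fintype.sum_prod_type]
  refine Prod.ext ?_ ?_
  · funext i
    simp [productVertex, Prod.fst_sum, Finset.sum_apply, Pi.single_apply]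
  · funext j
    simp only [productVertex, Prod.snd_sum, Finset.sum_apply, Prod.smul_snd, Pi.smul_apply,
      Pi.single_apply, smul_eq_mul, mul_ite, mul_one, mul_zero]
    simp

/-- The linear dependences of the Gale transform of the product of simplices are the matrices
`a i + b j`, because they are orthogonal to all the `2 × 2` circuits. -/
theorem sum_smul_galeTransform_productVertex_eq_zero {n m : ℕ} (i₀ : Fin n) (j₀ : Fin m)
    (c : Fin n × Fin m → ℝ) :
    ∑ p, c p • galeTransform (productVertex n m) p = 0 ↔
      ∃ (a : Fin n → ℝ) (b : Fin m → ℝ), ∀ i j, c (i, j) = a i + b j := by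
  have mem : ∀ d : Fin n × Fin m → ℝ,
      d ∈ LinearMap.ker (Fintype.linearCombination ℝ (productVertex n m)) ↔
        (∀ i, ∑ j, d (i, j) = 0) ∧ ∀ j, ∑ i, d (i, j) = 0 := by
    intro d
    rw [LinearMap.mem_ker, Fintype.linearCombination_apply, sum_smul_productVertex, Prod.ext_iff,
      funext_iff, funext_iff]
    rfl
  have app : ∀ d : LinearMap.ker (Fintype.linearCombination ℝ (productVertex n m)),
      (∑ p, c p • galeTransform (productVertex n m) p) d = ∑ p, c p * d.1 p := by
    intro d
    simp [galeTransform, LinearMap.sum_apply]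
  constructor
  · intro h
    refine ⟨fun i => c (i, j₀) - c (i₀, j₀), fun j => c (i₀, j), fun i j => ?_⟩
    have pick : ∀ {k : ℕ} (x y : Fin k) (f : Fin k → ℝ),
        ∑ z, f z * ((if z = x then 1 else 0) - if z = y then 1 else 0) = f x - f y := by
      intro k x y f
      simp [mul_sub, Finset.sum_sub_distrib]
    let u : Fin n → ℝ := fun z => (if z = i then 1 else 0) - if z = i₀ then 1 else 0
    let v : Fin m → ℝ := fun z => (if z = j then 1 else 0) - if z = j₀ then 1 else 0
    have hu : ∑ z, u z = 0 := by simp [u]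
    have hv : ∑ z, v z = 0 := by simp [v]
    have hd : (fun p => u p.1 * v p.2) ∈
        LinearMap.ker (Fintype.linearCombination ℝ (productVertex n m)) := by
      refine (mem _).2 ⟨fun i' => ?_, fun j' => ?_⟩
      · dsimp only
        rw [← Finset.mul_sum, hv, mul_zero]
      · dsimp only
        rw [← Finset.sum_mul, hu, zero_mul]
    have h' := app ⟨_, hd⟩
    have h'' : ∑ x, (∑ y, c (x, y) * v y) * u x = 0 := by
      rw [h, LinearMap.zero_apply, Fintype.sum_prod_type] at h'
      rw [h']
      refine Finset.sum_congr rfl fun x _ => ?_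
      rw [Finset.sum_mul]
      exact Finset.sum_congr rfl fun y _ => by ring
    simp only [u, v, pick] at h''
    linarith
  · rintro ⟨a, b, h⟩
    refine LinearMap.ext fun d => ?_
    obtain ⟨h1, h2⟩ := (mem d.1).1 d.2
    rw [app, LinearMap.zero_apply, Fintype.sum_prod_type]
    simp only [h, add_mul, Finset.sum_add_distrib]
    rw [Finset.sum_comm (f := fun i j => b j * d.1 (i, j))]
    simp only [← Finset.mul_sum, h1, h2, mul_zero, Finset.sum_const_zero, add_zero]

theorem exists_isVirtualChamber_productVertex {n m : ℕ} (hn : 2 ≤ n) (hm : 2 ≤ m)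
    (hnm : 4 ≤ n ∨ 4 ≤ m) :
    ∃ C : Set (Finset (Fin n × Fin m)), IsVirtualChamber (productVertex n m) C := by
  have hw := sum_smul_galeTransform_productVertex_eq_zero (n := n) (m := m) ⟨0, by omega⟩
    ⟨0, by omega⟩
  have h01 : ∀ (k : ℕ) (hk : 2 ≤ k), (⟨0, by omega⟩ : Fin k) ≠ ⟨1, by omega⟩ := by simp
  rcases hnm with h4 | h4
  · have hw' : ∀ c : Fin n × Fin m → ℝ, ∑ p, c p • galeTransform (productVertex n m) p = 0 ↔
        ∃ (a : Fin m → ℝ) (b : Fin n → ℝ),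
          ∀ i j, c (Equiv.prodComm (Fin m) (Fin n) (i, j)) = a i + b j := by
      intro c
      rw [hw]
      exact ⟨fun ⟨a, b, h⟩ => ⟨b, a, fun i j => (h j i).trans (add_comm _ _)⟩,
        fun ⟨a, b, h⟩ => ⟨b, a, fun i j => (h j i).trans (add_comm _ _)⟩⟩
    exact ⟨_, _, isVectorTriangulation_crossedFamily _ ⟨0, by omega⟩ ⟨1, by omega⟩
      (Fin.castLE h4) hw', not_isRegularTriangulation_crossedFamily _ (h01 m hm)
        (Fin.castLE_injective h4) hw', rfl⟩
  · exact ⟨_, _, isVectorTriangulation_crossedFamily (Equiv.refl _) ⟨0, by omega⟩ ⟨1, by omega⟩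
      (Fin.castLE h4) hw, not_isRegularTriangulation_crossedFamily (Equiv.refl _) (h01 n hn)
        (Fin.castLE_injective h4) hw, rfl⟩

end Gale

/-! ### Cuts and the simplices spanned by vertices -/

section Cuts

variable {n m : ℕ}

/-- The cut functional `(x, y) ↦ x(A) - y(B)`. If `A` and `B` are proper and nonempty, its zero set in the
affine hull of the polytope is spanned by the edges of the two complete bipartite graphs on `A ∪ B` and
on the complement of `A ∪ B`. -/
def cutForm (A : Finset (Fin n)) (B : Finset (Fin m)) : (Fin n → ℝ) × (Fin m → ℝ) →ₗ[ℝ] ℝ :=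
  (∑ i ∈ A, LinearMap.proj i) ∘ₗ LinearMap.fst ℝ _ _ -
    (∑ j ∈ B, LinearMap.proj j) ∘ₗ LinearMap.snd ℝ _ _

theorem cutForm_apply (A : Finset (Fin n)) (B : Finset (Fin m))
    (z : (Fin n → ℝ) × (Fin m → ℝ)) :
    cutForm A B z = ∑ i ∈ A, z.1 i - ∑ j ∈ B, z.2 j := by
  simp [cutForm]

theorem cutForm_productVertex (A : Finset (Fin n)) (B : Finset (Fin m)) (p : Fin n × Fin m) :
    cutForm A B (productVertex n m p) =
      (if p.1 ∈ A then 1 else 0) - (if p.2 ∈ B then 1 else 0) := by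
  rw [cutForm_apply]
  simp [productVertex]

theorem cutForm_productVertex_eq_zero_iff {A : Finset (Fin n)} {B : Finset (Fin m)}
    {p : Fin n × Fin m} : cutForm A B (productVertex n m p) = 0 ↔ (p.1 ∈ A ↔ p.2 ∈ B) := by
  rw [cutForm_productVertex]
  by_cases h1 : p.1 ∈ A <;> by_cases h2 : p.2 ∈ B <;> simp [h1, h2]

theorem cutForm_compl {z : (Fin n → ℝ) × (Fin m → ℝ)} (h1 : ∑ i, z.1 i = 1)
    (h2 : ∑ j, z.2 j = 1) (A : Finset (Fin n)) (B : Finset (Fin m)) :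
    cutForm Aᶜ Bᶜ z = - cutForm A B z := by
  rw [cutForm_apply, cutForm_apply]
  linarith [Finset.sum_add_sum_compl A z.1, Finset.sum_add_sum_compl B z.2]

theorem mem_convexHull_productVertex_iff {z : (Fin n → ℝ) × (Fin m → ℝ)} :
    z ∈ convexHull ℝ (range (productVertex n m)) ↔
      ((∀ i, 0 ≤ z.1 i) ∧ ∑ i, z.1 i = 1) ∧ (∀ j, 0 ≤ z.2 j) ∧ ∑ j, z.2 j = 1 := by
  rw [convexHull_range_productVertex]
  rfl

theorem mem_convexHull_image_finset_iff {ι E : Type*} [Fintype ι] [AddCommGroup E]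
    [Module ℝ E] {v : ι → E} {σ : Finset ι} {z : E} :
    z ∈ convexHull ℝ (v '' (σ : Set ι)) ↔ ∃ c : ι → ℝ, (∀ i, 0 ≤ c i) ∧ (∀ i ∉ σ, c i = 0) ∧
      ∑ i, c i = 1 ∧ ∑ i, c i • v i = z := by
  classical
  constructor
  · refine fun hz => convexHull_min (t := {z | ∃ c : ι → ℝ, (∀ i, 0 ≤ c i) ∧
      (∀ i ∉ σ, c i = 0) ∧ ∑ i, c i = 1 ∧ ∑ i, c i • v i = z}) ?_ ?_ hz
    · rintro _ ⟨i, hi, rfl⟩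
      refine ⟨Pi.single i 1, fun k => ?_, fun k hk => ?_, by simp, ?_⟩
      · rw [Pi.single_apply]; split_ifs <;> norm_num
      · rw [Pi.single_apply, if_neg]; rintro rfl; exact hk hi
      · simp [Pi.single_apply, ite_smul]
    · rintro _ ⟨c, hc, c0, c1, rfl⟩ _ ⟨d, hd, d0, d1, rfl⟩ a b ha hb hab
      refine ⟨fun i => a * c i + b * d i, fun i => ?_, fun i hi => ?_, ?_, ?_⟩
      · exact add_nonneg (mul_nonneg ha (hc i)) (mul_nonneg hb (hd i))
      · simp [c0 i hi, d0 i hi]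
      · rw [Finset.sum_add_distrib, ← Finset.mul_sum, ← Finset.mul_sum, c1, d1]; linarith
      · simp only [add_smul, mul_smul, Finset.sum_add_distrib, Finset.smul_sum]
  · rintro ⟨c, hc, c0, c1, rfl⟩
    have h1 : ∑ i ∈ σ, c i = 1 := by
      rw [← c1]; exact Finset.sum_subset (Finset.subset_univ σ) fun i _ hi => c0 i hi
    have h2 : ∑ i ∈ σ, c i • v i = ∑ i, c i • v i :=
      Finset.sum_subset (Finset.subset_univ σ) fun i _ hi => by rw [c0 i hi, zero_smul]
    rw [← h2]
    exact (convex_convexHull ℝ _).sum_mem (fun i _ => hc i) h1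
      fun i hi => subset_convexHull ℝ _ ⟨i, hi, rfl⟩

/-- A point outside the span of some vertices is separated from them by a cut: the level sets of
a linear functional that vanishes on the vertices are unions of connected components of the
corresponding graph, and the functional is a combination of the cuts given by its level sets. -/
theorem exists_cutForm_ne_zero {S : Set (Fin n × Fin m)} {z : (Fin n → ℝ) × (Fin m → ℝ)}
    (hz : z ∉ Submodule.span ℝ (productVertex n m '' S)) :
    ∃ A B, (∀ p ∈ S, cutForm A B (productVertex n m p) = 0) ∧ cutForm A B z ≠ 0 := by
  classical
  obtain ⟨f, hf, hS⟩ := Submodule.exists_le_ker_of_notMem hz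
  let a : Fin n → ℝ := fun i => f (Pi.single i 1, 0)
  let b : Fin m → ℝ := fun j => - f (0, Pi.single j 1)
  have hab : ∀ p ∈ S, a p.1 = b p.2 := by
    intro p hp
    have h : f (productVertex n m p) = 0 := hS (Submodule.subset_span ⟨p, hp, rfl⟩)
    have h2 : productVertex n m p = (Pi.single p.1 1, 0) + (0, Pi.single p.2 1) := by
      simp [productVertex]
    rw [h2, map_add] at h
    simp only [a, b]
    linarith
  have hfz : f z = ∑ i, z.1 i * a i - ∑ j, z.2 j * b j := by
    have h1 : z = ∑ i, z.1 i • ((Pi.single i 1, 0) : (Fin n → ℝ) × (Fin m → ℝ)) +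
        ∑ j, z.2 j • ((0, Pi.single j 1) : (Fin n → ℝ) × (Fin m → ℝ)) := by
      refine Prod.ext ?_ ?_
      · funext i
        simp [Prod.fst_sum, Finset.sum_apply, Pi.single_apply]
      · funext i
        simp [Prod.snd_sum, Finset.sum_apply, Pi.single_apply]
    conv_lhs => rw [h1]
    simp only [map_add, map_sum, map_smul, smul_eq_mul, a, b]
    simp [Finset.sum_neg_distrib]
  by_contra! hcon
  let K : Finset ℝ := Finset.univ.image a ∪ Finset.univ.image b
  have hlev : ∀ t ∈ K, ∑ i with a i = t, z.1 i - ∑ j with b j = t, z.2 j = 0 := by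
    intro t _
    rw [← cutForm_apply]
    refine hcon _ _ fun p hp => cutForm_productVertex_eq_zero_iff.2 ?_
    simp [hab p hp]
  apply hf
  have e1 : ∑ i, z.1 i * a i = ∑ t ∈ K, ∑ i with a i = t, z.1 i * t := by
    rw [← Finset.sum_fiberwise_of_maps_to (t := K) (g := a) fun i _ =>
      Finset.mem_union_left _ (Finset.mem_image_of_mem a (Finset.mem_univ i))]
    refine Finset.sum_congr rfl fun t _ => Finset.sum_congr rfl fun i hi => ?_
    rw [(Finset.mem_filter.1 hi).2]
  have e2 : ∑ j, z.2 j * b j = ∑ t ∈ K, ∑ j with b j = t, z.2 j * t := by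
    rw [← Finset.sum_fiberwise_of_maps_to (t := K) (g := b) fun i _ =>
      Finset.mem_union_right _ (Finset.mem_image_of_mem b (Finset.mem_univ i))]
    refine Finset.sum_congr rfl fun t _ => Finset.sum_congr rfl fun i hi => ?_
    rw [(Finset.mem_filter.1 hi).2]
  rw [hfz, e1, e2, ← Finset.sum_sub_distrib]
  refine Finset.sum_eq_zero fun t ht => ?_
  rw [← Finset.sum_mul, ← Finset.sum_mul, ← sub_mul, hlev t ht, zero_mul]

theorem sum_eq_of_sum_smul_productVertex {c : Fin n × Fin m → ℝ}
    {z : (Fin n → ℝ) × (Fin m → ℝ)} (h : ∑ p, c p • productVertex n m p = z) :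
    ∑ p, c p = ∑ i, z.1 i := by
  rw [← h, sum_smul_productVertex, Fintype.sum_prod_type]

/-- The product coupling represents every point of the affine hull. -/
theorem sum_mul_smul_productVertex {z : (Fin n → ℝ) × (Fin m → ℝ)} (h1 : ∑ i, z.1 i = 1)
    (h2 : ∑ j, z.2 j = 1) :
    ∑ p, (z.1 p.1 * z.2 p.2) • productVertex n m p = z := by
  rw [sum_smul_productVertex (fun p => z.1 p.1 * z.2 p.2)]
  simp only [← Finset.mul_sum, ← Finset.sum_mul, h1, h2, one_mul, mul_one]

theorem mem_span_image_iff_exists_sum {ι E : Type*} [Fintype ι] [AddCommGroup E] [Module ℝ E]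
    {v : ι → E} {S : Set ι} {z : E} :
    z ∈ Submodule.span ℝ (v '' S) ↔
      ∃ c : ι → ℝ, (∀ i ∉ S, c i = 0) ∧ ∑ i, c i • v i = z := by
  classical
  constructor
  · intro hz
    induction hz using Submodule.span_induction with
    | mem x hx =>
      obtain ⟨i, hi, rfl⟩ := hx
      refine ⟨Pi.single i 1, fun k hk => ?_, ?_⟩
      · rw [Pi.single_apply, if_neg]; rintro rfl; exact hk hi
      · simp [Pi.single_apply, ite_smul]
    | zero => exact ⟨0, by simp, by simp⟩
    | add x y _ _ hx hy =>
      obtain ⟨c, c0, rfl⟩ := hx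
      obtain ⟨d, d0, rfl⟩ := hy
      exact ⟨c + d, fun i hi => by simp [c0 i hi, d0 i hi],
        by simp [add_smul, Finset.sum_add_distrib]⟩
    | smul t x _ hx =>
      obtain ⟨c, c0, rfl⟩ := hx
      exact ⟨t • c, fun i hi => by simp [c0 i hi], by simp [mul_smul, Finset.smul_sum]⟩
  · rintro ⟨c, c0, rfl⟩
    refine Submodule.sum_mem _ fun i _ => ?_
    by_cases hi : i ∈ S
    · exact Submodule.smul_mem _ _ (Submodule.subset_span ⟨i, hi, rfl⟩)
    · rw [c0 i hi, zero_smul]; exact Submodule.zero_mem _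

/-- All vertices lie on an affine hyperplane that misses the origin, so affine independence of
vertices is linear independence. -/
theorem eq_zero_of_affineIndependent {σ : Finset (Fin n × Fin m)}
    (hσ : AffineIndependent ℝ fun p : σ => productVertex n m p) {c : Fin n × Fin m → ℝ}
    (c0 : ∀ p ∉ σ, c p = 0) (hc : ∑ p, c p • productVertex n m p = 0) : c = 0 := by
  have hsum : ∑ p, c p = 0 := by
    rw [sum_eq_of_sum_smul_productVertex hc]; simp
  rw [affineIndependent_iff] at hσ
  have key := hσ Finset.univ (fun p => c p) (by
      rw [Finset.sum_coe_sort σ c, ← hsum]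
      exact Finset.sum_subset (Finset.subset_univ σ) fun p _ hp => c0 p hp) (by
      rw [Finset.sum_coe_sort σ fun p => c p • productVertex n m p, ← hc]
      exact Finset.sum_subset (Finset.subset_univ σ) fun p _ hp => by rw [c0 p hp, zero_smul])
  funext p
  by_cases hp : p ∈ σ
  · exact key ⟨p, hp⟩ (Finset.mem_univ _)
  · exact c0 p hp

/-- A simplex spanned by vertices is cut out of the polytope by the cuts that are nonnegative on
it: the barycentric coordinates are cuts, because deleting an edge from a forest disconnects
its end points. -/
theorem mem_convexHull_image_of_cutForm_nonneg {σ : Finset (Fin n × Fin m)}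
    (hσ : AffineIndependent ℝ fun p : σ => productVertex n m p)
    {z : (Fin n → ℝ) × (Fin m → ℝ)} (hz : z ∈ convexHull ℝ (range (productVertex n m)))
    (h : ∀ A B, (∀ p ∈ σ, 0 ≤ cutForm A B (productVertex n m p)) → 0 ≤ cutForm A B z) :
    z ∈ convexHull ℝ (productVertex n m '' (σ : Set (Fin n × Fin m))) := by
  classical
  obtain ⟨⟨-, z1⟩, -, z2⟩ := mem_convexHull_productVertex_iff.1 hz
  have vsum : ∀ p, (∑ i, (productVertex n m p).1 i = 1) ∧ ∑ j, (productVertex n m p).2 j = 1 :=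
    fun p => by simp [productVertex]
  have hspan : z ∈ Submodule.span ℝ (productVertex n m '' (σ : Set (Fin n × Fin m))) := by
    by_contra hcon
    obtain ⟨A, B, h0, hne⟩ := exists_cutForm_ne_zero hcon
    have h1 := h A B fun p hp => (h0 p hp).ge
    have h2 := h Aᶜ Bᶜ fun p hp => by
      rw [cutForm_compl (vsum p).1 (vsum p).2, h0 p hp, neg_zero]
    rw [cutForm_compl z1 z2] at h2
    exact hne (by linarith)
  obtain ⟨c, c0, rfl⟩ := mem_span_image_iff_exists_sum.1 hspan
  refine mem_convexHull_image_finset_iff.2 ⟨c, fun p => ?_, c0, ?_, rfl⟩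
  · by_cases hp : p ∈ σ
    -- Up to a positive factor, the coordinate at `p` is a cut that vanishes on the other vertices of
    -- the simplex and is positive at `p`; its sign is arranged by passing to complements.
    · have hnot : productVertex n m p ∉
          Submodule.span ℝ (productVertex n m '' ((σ.erase p : Finset _) : Set (Fin n × Fin m))) := by
        intro hcon
        obtain ⟨d, d0, hd⟩ := mem_span_image_iff_exists_sum.1 hcon
        have h0 := eq_zero_of_affineIndependent hσ (c := d - Pi.single p 1) (fun q hq => by
            have hqp : q ≠ p := fun h => hq (h ▸ hp)
            simp [d0 q (by simp [hq]), hqp]) (by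
            simp [sub_smul, Finset.sum_sub_distrib, hd, Pi.single_apply, ite_smul])
        have h1 := congrFun h0 p
        simp [d0 p (by simp)] at h1
      obtain ⟨A, B, hA, hne⟩ := exists_cutForm_ne_zero hnot
      have hval : ∀ A B, (∀ q ∈ σ.erase p, cutForm A B (productVertex n m q) = 0) →
          cutForm A B (∑ q, c q • productVertex n m q) =
            c p * cutForm A B (productVertex n m p) := by
        intro A B hAB
        rw [map_sum, Finset.sum_eq_single p]
        · simp
        · intro q _ hqp
          by_cases hq : q ∈ σ
          · simp [hAB q (Finset.mem_erase.2 ⟨hqp, hq⟩)]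
          · simp [c0 q hq]
        · simp
      have hkey : ∀ A B, (∀ q ∈ σ.erase p, cutForm A B (productVertex n m q) = 0) →
          0 < cutForm A B (productVertex n m p) → 0 ≤ c p := by
        intro A B hAB hpos
        have h1 := h A B fun q hq => by
          by_cases hqp : q = p
          · rw [hqp]; exact hpos.le
          · exact (hAB q (Finset.mem_erase.2 ⟨hqp, hq⟩)).ge
        rw [hval A B hAB] at h1
        exact nonneg_of_mul_nonneg_left h1 hpos
      rcases lt_or_gt_of_ne hne with hlt | hlt
      · refine hkey Aᶜ Bᶜ (fun q hq => ?_) ?_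
        · rw [cutForm_compl (vsum q).1 (vsum q).2, hA q hq, neg_zero]
        · rw [cutForm_compl (vsum p).1 (vsum p).2]; linarith
      · exact hkey A B hA hlt
    · exact (c0 p hp).ge
  · rw [sum_eq_of_sum_smul_productVertex rfl, z1]

end Cuts

/-! ### Staircase triangulations -/

section Staircase

/-- A down-closed family is a triangulation as soon as every point of the polytope has exactly one
representation as a convex combination whose support belongs to the family. (Uniqueness is
asked for all nonnegative combinations, so that it gives affine independence as well.) -/
theorem IsPointTriangulation.of_unique_representation {ι E : Type*} [Fintype ι] [DecidableEq ι]
    [AddCommGroup E] [Module ℝ E] {v : ι → E} {T : Set (Finset ι)}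
    (down : ∀ σ ∈ T, ∀ τ ⊆ σ, τ ∈ T)
    (ex : ∀ z ∈ convexHull ℝ (range v), ∃ d : ι → ℝ, (∀ i, 0 ≤ d i) ∧
      Finset.univ.filter (d · ≠ 0) ∈ T ∧ ∑ i, d i = 1 ∧ ∑ i, d i • v i = z)
    (uniq : ∀ c d : ι → ℝ, (∀ i, 0 ≤ c i) → (∀ i, 0 ≤ d i) →
      Finset.univ.filter (c · ≠ 0) ∈ T → Finset.univ.filter (d · ≠ 0) ∈ T →
      ∑ i, c i • v i = ∑ i, d i • v i → c = d) :
    IsPointTriangulation v T := by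
  have supp : ∀ σ ∈ T, ∀ c : ι → ℝ, (∀ i ∉ σ, c i = 0) → Finset.univ.filter (c · ≠ 0) ∈ T := by
    intro σ hσ c hc
    refine down σ hσ _ fun i hi => ?_
    by_contra h
    exact (Finset.mem_filter.1 hi).2 (hc i h)
  refine ⟨fun σ hσ => (linearIndependent_of_unique_representation
    fun c d hc hd hcσ hdσ => uniq c d hc hd (supp σ hσ c hcσ) (supp σ hσ d hdσ)).affineIndependent,
    down, fun σ hσ τ hτ => ?_, ?_⟩
  · ext x
    constructor
    · rintro ⟨h1, h2⟩
      obtain ⟨c, hc, hcσ, c1, rfl⟩ := mem_convexHull_image_finset_iff.1 h1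
      obtain ⟨d, hd, hdτ, -, h⟩ := mem_convexHull_image_finset_iff.1 h2
      obtain rfl := uniq d c hd hc (supp τ hτ d hdτ) (supp σ hσ c hcσ) h
      refine mem_convexHull_image_finset_iff.2 ⟨d, hd, fun i hi => ?_, c1, rfl⟩
      by_cases his : i ∈ σ
      · exact hdτ i fun hit => hi (Finset.mem_inter.2 ⟨his, hit⟩)
      · exact hcσ i his
    · intro h
      exact ⟨convexHull_mono (image_mono fun i hi => (Finset.mem_inter.1 hi).1) h,
        convexHull_mono (image_mono fun i hi => (Finset.mem_inter.1 hi).2) h⟩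
  · refine subset_antisymm (iUnion₂_subset fun σ _ => convexHull_mono (image_subset_range _ _))
      fun z hz => ?_
    obtain ⟨d, hd, hT, d1, h⟩ := ex z hz
    refine mem_iUnion₂.2 ⟨_, hT, mem_convexHull_image_finset_iff.2 ⟨d, hd, fun i hi => ?_, d1, h⟩⟩
    by_contra h'
    exact hi (Finset.mem_filter.2 ⟨Finset.mem_univ i, h'⟩)

variable {n m : ℕ}

/-- The staircase triangulation with respect to orderings of the two factors given by `r` and `s`:
its simplices are the chains of the product order. -/
def staircase (r : Fin n → ℕ) (s : Fin m → ℕ) : Set (Finset (Fin n × Fin m)) :=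
  {σ | ∀ p ∈ σ, ∀ q ∈ σ, r p.1 < r q.1 → s p.2 ≤ s q.2}

/-- The mass that a coupling supported on a chain puts on a lower left corner is the minimum of the
masses of the corresponding rows and columns. -/
theorem corner_sum_eq_min {r : Fin n → ℕ} {s : Fin m → ℕ} {c : Fin n × Fin m → ℝ}
    (hc : ∀ p, 0 ≤ c p) (hT : Finset.univ.filter (c · ≠ 0) ∈ staircase r s) (i j : ℕ) :
    ∑ p with r p.1 ≤ i ∧ s p.2 ≤ j, c p = min (∑ p with r p.1 ≤ i, c p) (∑ p with s p.2 ≤ j, c p) := by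
  apply le_antisymm
  · refine le_min ?_ ?_ <;>
    · refine Finset.sum_le_sum_of_subset_of_nonneg (fun p hp => ?_) fun p _ _ => hc p
      simp only [Finset.mem_filter, Finset.mem_univ, true_and] at hp ⊢
      tauto
  · by_cases h : ∃ p, c p ≠ 0 ∧ r p.1 ≤ i ∧ j < s p.2
    · obtain ⟨p, hp, hpi, hpj⟩ := h
      refine min_le_of_right_le (le_of_eq (Finset.sum_subset_zero_on_sdiff (fun q hq => ?_)
        (fun q hq => ?_) fun _ _ => rfl).symm)
      · simp only [Finset.mem_filter, Finset.mem_univ, true_and] at hq ⊢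
        exact hq.2
      · simp only [Finset.mem_sdiff, Finset.mem_filter, Finset.mem_univ, true_and, not_and,
          not_le] at hq
        by_contra hq0
        have := hT p (by simpa using hp) q (by simpa using hq0)
        by_cases hqi : r q.1 ≤ i
        · have := hq.2 hqi; omega
        · have := this (by omega); omega
    · push Not at h
      refine min_le_of_left_le (le_of_eq (Finset.sum_subset_zero_on_sdiff (fun q hq => ?_)
        (fun q hq => ?_) fun _ _ => rfl).symm)
      · simp only [Finset.mem_filter, Finset.mem_univ, true_and] at hq ⊢
        exact hq.1
      · simp only [Finset.mem_sdiff, Finset.mem_filter, Finset.mem_univ, true_and, not_and,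
          not_le] at hq
        by_contra hq0
        have := h q hq0 hq.1
        have := hq.2 hq.1
        omega

theorem staircase_unique {r : Fin n → ℕ} {s : Fin m → ℕ} (hr : Function.Injective r)
    (hs : Function.Injective s) {c d : Fin n × Fin m → ℝ} (hc : ∀ p, 0 ≤ c p) (hd : ∀ p, 0 ≤ d p)
    (hcT : Finset.univ.filter (c · ≠ 0) ∈ staircase r s)
    (hdT : Finset.univ.filter (d · ≠ 0) ∈ staircase r s)
    (h : ∑ p, c p • productVertex n m p = ∑ p, d p • productVertex n m p) : c = d := by
  rw [sum_smul_productVertex, sum_smul_productVertex, Prod.mk.injEq, funext_iff, funext_iff] at h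
  obtain ⟨h1, h2⟩ := h
  have corner : ∀ i j : ℕ, ∑ p with r p.1 ≤ i ∧ s p.2 ≤ j, c p =
      ∑ p with r p.1 ≤ i ∧ s p.2 ≤ j, d p := by
    intro i j
    rw [corner_sum_eq_min hc hcT, corner_sum_eq_min hd hdT]
    congr 1
    · simp only [Finset.sum_filter]
      rw [Fintype.sum_prod_type, Fintype.sum_prod_type]
      refine Finset.sum_congr rfl fun x _ => ?_
      dsimp only
      split_ifs
      · exact h1 x
      · rfl
    · simp only [Finset.sum_filter]
      rw [Fintype.sum_prod_type_right, Fintype.sum_prod_type_right]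
      refine Finset.sum_congr rfl fun x _ => ?_
      dsimp only
      split_ifs
      · exact h2 x
      · rfl
  have key : ∀ N, ∀ p : Fin n × Fin m, r p.1 + s p.2 = N → c p = d p := by
    intro N
    induction N using Nat.strong_induction_on with
    | _ N ih =>
      intro p hp
      have h0 := corner (r p.1) (s p.2)
      have hmem : p ∈ Finset.univ.filter fun q : Fin n × Fin m => r q.1 ≤ r p.1 ∧ s q.2 ≤ s p.2 := by
        simp
      rw [← Finset.add_sum_erase _ _ hmem, ← Finset.add_sum_erase _ _ hmem] at h0
      have h3 := Finset.sum_congr (s₁ := (Finset.univ.filter fun q : Fin n × Fin m =>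
        r q.1 ≤ r p.1 ∧ s q.2 ≤ s p.2).erase p) (f := c) (g := d) rfl fun q hq => by
          simp only [Finset.mem_erase, Finset.mem_filter, Finset.mem_univ, true_and] at hq
          refine ih _ ?_ q rfl
          by_contra hlt
          exact hq.1 (Prod.ext (hr (by omega)) (hs (by omega)))
      linarith
  exact funext fun p => key _ p rfl

/-- Every point of the polytope is the pair of marginals of a coupling supported on a chain: a
coupling that maximizes `∑ r i * s j * c (i, j)` admits no crossing. -/
theorem staircase_exists (r : Fin n → ℕ) (s : Fin m → ℕ) {z : (Fin n → ℝ) × (Fin m → ℝ)}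
    (hz : z ∈ convexHull ℝ (range (productVertex n m))) :
    ∃ c : Fin n × Fin m → ℝ, (∀ p, 0 ≤ c p) ∧ Finset.univ.filter (c · ≠ 0) ∈ staircase r s ∧
      ∑ p, c p = 1 ∧ ∑ p, c p • productVertex n m p = z := by
  obtain ⟨⟨z0, z1⟩, z0', z2⟩ := mem_convexHull_productVertex_iff.1 hz
  let K : Set (Fin n × Fin m → ℝ) := {c | (∀ p, 0 ≤ c p) ∧ ∑ p, c p • productVertex n m p = z}
  have hsum : ∀ c ∈ K, ∑ p, c p = 1 := fun c hc =>
    (sum_eq_of_sum_smul_productVertex hc.2).trans z1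
  have hclosed : IsClosed K := by
    refine IsClosed.inter (s₁ := {c : Fin n × Fin m → ℝ | ∀ p, 0 ≤ c p}) ?_ ?_
    · simp only [ofPred_forall]
      exact isClosed_iInter fun p => isClosed_le continuous_const (continuous_apply p)
    · exact isClosed_eq (by fun_prop) continuous_const
  have hK : IsCompact K := by
    refine isCompact_Icc.of_isClosed_subset (s := Icc 0 1) hclosed fun c hc => ⟨hc.1, fun p => ?_⟩
    have := hsum c hc
    rw [Pi.one_apply, ← this]
    exact Finset.single_le_sum (fun q _ => hc.1 q) (Finset.mem_univ p)
  have hne : K.Nonempty := ⟨fun p => z.1 p.1 * z.2 p.2, fun p => mul_nonneg (z0 _) (z0' _),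
    sum_mul_smul_productVertex z1 z2⟩
  obtain ⟨c, hcK, hmax⟩ := hK.exists_isMaxOn hne
    (f := fun c : Fin n × Fin m → ℝ => ∑ p, ((r p.1 : ℝ) * s p.2) * c p) (by fun_prop)
  refine ⟨c, hcK.1, ?_, hsum c hcK, hcK.2⟩
  intro p hp q hq hr
  by_contra! hs
  have hp0 : 0 < c p := lt_of_le_of_ne (hcK.1 p) (Ne.symm (by simpa using hp))
  have hq0 : 0 < c q := lt_of_le_of_ne (hcK.1 q) (Ne.symm (by simpa using hq))
  have hpq : p ≠ q := fun h => by rw [h] at hr; exact lt_irrefl _ hr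
  obtain ⟨ε, hε, hεp, hεq⟩ : ∃ ε, 0 < ε ∧ ε ≤ c p ∧ ε ≤ c q :=
    ⟨min (c p) (c q), lt_min hp0 hq0, min_le_left _ _, min_le_right _ _⟩
  -- Uncross the pair `p`, `q`.
  let u : Fin n × Fin m → ℝ := Pi.single (p.1, q.2) 1 + Pi.single (q.1, p.2) 1 -
    Pi.single p 1 - Pi.single q 1
  have single_nonneg : ∀ x y : Fin n × Fin m, (0 : ℝ) ≤ (Pi.single x 1 : _ → ℝ) y := by
    intro x y
    rw [Pi.single_apply]; split_ifs <;> norm_num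
  have hmem : c + ε • u ∈ K := by
    constructor
    · intro x
      have e1 := single_nonneg (p.1, q.2) x
      have e2 := single_nonneg (q.1, p.2) x
      have e3 := hcK.1 x
      simp only [u, Pi.add_apply, Pi.smul_apply, Pi.sub_apply, smul_eq_mul]
      by_cases hxp : x = p
      · subst hxp
        rw [Pi.single_eq_same, Pi.single_eq_of_ne hpq]
        nlinarith
      · by_cases hxq : x = q
        · subst hxq
          rw [Pi.single_eq_same, Pi.single_eq_of_ne hxp]
          nlinarith
        · rw [Pi.single_eq_of_ne hxp, Pi.single_eq_of_ne hxq]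
          nlinarith
    · have hu : ∑ x, u x • productVertex n m x = 0 := by
        simp only [u, Pi.sub_apply, Pi.add_apply, sub_smul, add_smul, Finset.sum_sub_distrib,
          Finset.sum_add_distrib, Pi.single_apply, ite_smul, one_smul, zero_smul,
          Finset.sum_ite_eq', Finset.mem_univ, if_true]
        simp [productVertex]
      simp only [Pi.add_apply, Pi.smul_apply, smul_eq_mul, add_smul, mul_smul,
        Finset.sum_add_distrib, ← Finset.smul_sum, hu, smul_zero, add_zero]
      exact hcK.2
  have hle : ∑ x, ((r x.1 : ℝ) * s x.2) * (c + ε • u) x ≤ ∑ x, ((r x.1 : ℝ) * s x.2) * c x :=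
    hmax hmem
  have hu : ∑ x, ((r x.1 : ℝ) * s x.2) * u x = ((r q.1 : ℝ) - r p.1) * (s p.2 - s q.2) := by
    simp only [u, Pi.sub_apply, Pi.add_apply, mul_sub, mul_add, Finset.sum_sub_distrib,
      Finset.sum_add_distrib, Pi.single_apply, mul_ite, mul_one, mul_zero,
      Finset.sum_ite_eq', Finset.mem_univ, if_true]
    ring
  simp only [Pi.add_apply, Pi.smul_apply, smul_eq_mul, mul_add, Finset.sum_add_distrib,
    mul_left_comm _ ε, ← Finset.mul_sum, hu] at hle
  have h1 : (0 : ℝ) < (r q.1 : ℝ) - r p.1 := by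
    rw [sub_pos]; exact_mod_cast hr
  have h2 : (0 : ℝ) < (s p.2 : ℝ) - s q.2 := by
    rw [sub_pos]; exact_mod_cast hs
  linarith [mul_pos hε (mul_pos h1 h2)]

theorem isPointTriangulation_staircase {r : Fin n → ℕ} {s : Fin m → ℕ}
    (hr : Function.Injective r) (hs : Function.Injective s) :
    IsPointTriangulation (productVertex n m) (staircase r s) :=
  .of_unique_representation (fun _ hσ _ hτ p hp q hq => hσ p (hτ hp) q (hτ hq))
    (fun _ hz => staircase_exists r s hz)
    fun _ _ hc hd hcT hdT h => staircase_unique hr hs hc hd hcT hdT h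

/-- No cut properly intersects all triangulations: in the staircase triangulation for orderings that
start with `A` and with `B`, every simplex is on one side of the cut. -/
theorem exists_triangulation_one_sided (A : Finset (Fin n)) (B : Finset (Fin m)) :
    ∃ T, IsPointTriangulation (productVertex n m) T ∧ ∀ σ ∈ T,
      (∀ p ∈ σ, 0 ≤ cutForm A B (productVertex n m p)) ∨
        ∀ p ∈ σ, cutForm A B (productVertex n m p) ≤ 0 := by
  let rank : ∀ {k : ℕ}, Finset (Fin k) → Fin k → ℕ := fun {k} A i => if i ∈ A then i else k + i
  have hinj : ∀ {k : ℕ} (A : Finset (Fin k)), Function.Injective (rank A) := by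
    intro k A i j hij
    simp only [rank] at hij
    split_ifs at hij <;> (apply Fin.ext; omega)
  refine ⟨_, isPointTriangulation_staircase (hinj A) (hinj B), fun σ hσ => ?_⟩
  by_contra! hcon
  obtain ⟨⟨p, hp, hp0⟩, q, hq, hq0⟩ := hcon
  rw [cutForm_productVertex] at hp0 hq0
  have hpA : p.1 ∉ A ∧ p.2 ∈ B := by
    split_ifs at hp0 with h1 h2 h2 <;> simp_all; linarith
  have hqA : q.1 ∈ A ∧ q.2 ∉ B := by
    split_ifs at hq0 with h1 h2 h2 <;> simp_all; linarith
  have h := hσ q hq p hp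
  simp only [rank, hpA, hqA, if_true, if_false] at h
  have := h (by omega)
  omega

end Staircase

/-! ### The chamber complex is the subdivision by cuts -/

section Cells

variable {n m : ℕ}

/-- The smallest closed cell containing `z` of the subdivision of the polytope by all cuts. Both sides
of a cut occur, since passing to complements changes the sign of the cut. -/
def cutCell (z : (Fin n → ℝ) × (Fin m → ℝ)) : Set ((Fin n → ℝ) × (Fin m → ℝ)) :=
  {w | w ∈ convexHull ℝ (range (productVertex n m)) ∧
    ∀ A B, 0 ≤ cutForm A B z → 0 ≤ cutForm A B w}

theorem self_mem_cutCell {z : (Fin n → ℝ) × (Fin m → ℝ)}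
    (hz : z ∈ convexHull ℝ (range (productVertex n m))) : z ∈ cutCell z :=
  ⟨hz, fun _ _ h => h⟩

theorem cutForm_eq_zero_of_mem_cutCell {z w : (Fin n → ℝ) × (Fin m → ℝ)}
    (hz : z ∈ convexHull ℝ (range (productVertex n m))) (hw : w ∈ cutCell z)
    {A : Finset (Fin n)} {B : Finset (Fin m)} (h : cutForm A B z = 0) : cutForm A B w = 0 := by
  obtain ⟨⟨-, z1⟩, -, z2⟩ := mem_convexHull_productVertex_iff.1 hz
  obtain ⟨⟨-, w1⟩, -, w2⟩ := mem_convexHull_productVertex_iff.1 hw.1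
  have h1 := hw.2 A B h.ge
  have h2 := hw.2 Aᶜ Bᶜ (by rw [cutForm_compl z1 z2, h, neg_zero])
  rw [cutForm_compl w1 w2] at h2
  linarith

/-- A convex set on which each of finitely many functionals has constant sign contains a point where
a functional vanishes only if it vanishes on the whole set. -/
theorem Convex.exists_generic_mem {κ E : Type*} [Fintype κ] [Nonempty κ] [AddCommGroup E]
    [Module ℝ E] {C : Set E} (hC : Convex ℝ C) (hne : C.Nonempty) (g : κ → E →ₗ[ℝ] ℝ)
    (hg : ∀ k, (∀ w ∈ C, 0 ≤ g k w) ∨ ∀ w ∈ C, g k w ≤ 0) :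
    ∃ z ∈ C, ∀ k, g k z = 0 → ∀ w ∈ C, g k w = 0 := by
  have hu : ∀ k, ∃ u ∈ C, g k u = 0 → ∀ w ∈ C, g k w = 0 := by
    intro k
    by_cases h : ∃ u ∈ C, g k u ≠ 0
    · obtain ⟨u, hu, hne⟩ := h
      exact ⟨u, hu, fun h => absurd h hne⟩
    · push Not at h
      obtain ⟨u, hu⟩ := hne
      exact ⟨u, hu, fun _ => h⟩
  choose u huC hu using hu
  have hcard : (0 : ℝ) < Fintype.card κ := by exact_mod_cast Fintype.card_pos
  refine ⟨∑ k, (Fintype.card κ : ℝ)⁻¹ • u k, hC.sum_mem (fun _ _ => by positivity)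
    (by simp [hcard.ne']) fun k _ => huC k, fun k hk => hu k ?_⟩
  rw [map_sum] at hk
  simp only [map_smul, smul_eq_mul] at hk
  rw [← Finset.mul_sum, mul_eq_zero, or_iff_right (by positivity)] at hk
  rcases hg k with h | h
  · exact (Finset.sum_eq_zero_iff_of_nonneg fun l _ => h _ (huC l)).1 hk k (Finset.mem_univ k)
  · exact (Finset.sum_eq_zero_iff_of_nonpos fun l _ => h _ (huC l)).1 hk k (Finset.mem_univ k)

theorem exists_subset_cutCell {C : Set ((Fin n → ℝ) × (Fin m → ℝ))} (hC : Convex ℝ C)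
    (hne : C.Nonempty) (hsub : C ⊆ convexHull ℝ (range (productVertex n m)))
    (hside : ∀ A B, (∀ w ∈ C, 0 ≤ cutForm A B w) ∨ ∀ w ∈ C, cutForm A B w ≤ 0) :
    ∃ z ∈ C, C ⊆ cutCell z := by
  obtain ⟨z, hz, hgen⟩ := hC.exists_generic_mem hne
    (fun k : Finset (Fin n) × Finset (Fin m) => cutForm k.1 k.2) fun k => hside k.1 k.2
  refine ⟨z, hz, fun w hw => ⟨hsub hw, fun A B h => ?_⟩⟩
  rcases hside A B with h1 | h1
  · exact h1 w hw
  · exact (hgen (A, B) (le_antisymm (h1 z hz) h) w hw).ge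

theorem cutForm_nonneg_of_mem_convexHull_image {σ : Finset (Fin n × Fin m)} {A : Finset (Fin n)}
    {B : Finset (Fin m)} (h : ∀ p ∈ σ, 0 ≤ cutForm A B (productVertex n m p))
    {z : (Fin n → ℝ) × (Fin m → ℝ)}
    (hz : z ∈ convexHull ℝ (productVertex n m '' (σ : Set (Fin n × Fin m)))) :
    0 ≤ cutForm A B z := by
  refine convexHull_min (t := {z | 0 ≤ cutForm A B z}) ?_ ?_ hz
  · rintro _ ⟨p, hp, rfl⟩
    exact h p hp
  · exact convex_halfSpace_ge (cutForm A B).isLinear 0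

theorem cutForm_nonpos_of_mem_convexHull_image {σ : Finset (Fin n × Fin m)} {A : Finset (Fin n)}
    {B : Finset (Fin m)} (h : ∀ p ∈ σ, cutForm A B (productVertex n m p) ≤ 0)
    {z : (Fin n → ℝ) × (Fin m → ℝ)}
    (hz : z ∈ convexHull ℝ (productVertex n m '' (σ : Set (Fin n × Fin m)))) :
    cutForm A B z ≤ 0 := by
  refine convexHull_min (t := {z | cutForm A B z ≤ 0}) ?_ ?_ hz
  · rintro _ ⟨p, hp, rfl⟩
    exact h p hp
  · exact convex_halfSpace_le (cutForm A B).isLinear 0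

/-- The cell of `z` is the intersection of the carriers of `z`: simplices are intersections of sides
of cuts, and conversely every cut is respected by some triangulation. -/
theorem chamberComplex_productVertex :
    chamberComplex (productVertex n m) =
      {C | ∃ z ∈ convexHull ℝ (range (productVertex n m)), C = cutCell z} := by
  ext C
  constructor
  · rintro ⟨hne, f, hf, rfl⟩
    obtain ⟨T₀, hT₀, -⟩ := exists_triangulation_one_sided (∅ : Finset (Fin n)) (∅ : Finset (Fin m))
    have hsub : (⋂ T, convexHull ℝ (productVertex n m '' (f T : Set (Fin n × Fin m)))) ⊆
        convexHull ℝ (range (productVertex n m)) :=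
      (iInter_subset _ ⟨T₀, hT₀⟩).trans (convexHull_mono (image_subset_range _ _))
    obtain ⟨z, hz, hcell⟩ := exists_subset_cutCell
      (convex_iInter fun T => convex_convexHull ℝ _) hne hsub fun A B => by
        obtain ⟨T, hT, hAB⟩ := exists_triangulation_one_sided A B
        refine (hAB _ (hf ⟨T, hT⟩)).imp (fun h w hw => ?_) fun h w hw => ?_
        · exact cutForm_nonneg_of_mem_convexHull_image h (mem_iInter.1 hw ⟨T, hT⟩)
        · exact cutForm_nonpos_of_mem_convexHull_image h (mem_iInter.1 hw ⟨T, hT⟩)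
    refine ⟨z, hsub hz, subset_antisymm hcell fun w hw => mem_iInter.2 fun T => ?_⟩
    exact mem_convexHull_image_of_cutForm_nonneg (T.2.indep _ (hf T)) hw.1 fun A B hAB =>
      hw.2 A B (cutForm_nonneg_of_mem_convexHull_image hAB (mem_iInter.1 hz T))
  · rintro ⟨z, hz, rfl⟩
    refine ⟨⟨z, self_mem_cutCell hz⟩, ?_⟩
    have hcar : ∀ T : {T : Set (Finset (Fin n × Fin m)) //
        IsPointTriangulation (productVertex n m) T}, ∃ σ ∈ T.1, ∃ c : Fin n × Fin m → ℝ,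
          (∀ p ∈ σ, 0 < c p) ∧ (∀ p ∉ σ, c p = 0) ∧ ∑ p, c p = 1 ∧
            ∑ p, c p • productVertex n m p = z := by
      intro T
      have hz' := hz
      rw [← T.2.cover] at hz'
      obtain ⟨σ, hσ, hzσ⟩ := mem_iUnion₂.1 hz'
      obtain ⟨c, hc, c0, c1, hcz⟩ := mem_convexHull_image_finset_iff.1 hzσ
      refine ⟨Finset.univ.filter (c · ≠ 0), T.2.down σ hσ _ fun p hp => ?_, c, fun p hp => ?_,
        fun p hp => by simpa using hp, c1, hcz⟩
      · by_contra h
        exact (Finset.mem_filter.1 hp).2 (c0 p h)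
      · exact lt_of_le_of_ne (hc p) (Ne.symm (Finset.mem_filter.1 hp).2)
    choose f hf c hcpos hc0 hc1 hcz using hcar
    have hzf : ∀ T, z ∈ convexHull ℝ (productVertex n m '' (f T : Set (Fin n × Fin m))) := by
      refine fun T => mem_convexHull_image_finset_iff.2 ⟨c T, fun p => ?_, hc0 T, hc1 T, hcz T⟩
      by_cases hp : p ∈ f T
      · exact (hcpos T p hp).le
      · exact (hc0 T p hp).ge
    refine ⟨f, hf, subset_antisymm (fun w hw => mem_iInter.2 fun T => ?_) fun w hw => ⟨?_, ?_⟩⟩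
    · exact mem_convexHull_image_of_cutForm_nonneg (T.2.indep _ (hf T)) hw.1 fun A B hAB =>
        hw.2 A B (cutForm_nonneg_of_mem_convexHull_image hAB (hzf T))
    · obtain ⟨T₀, hT₀, -⟩ :=
        exists_triangulation_one_sided (∅ : Finset (Fin n)) (∅ : Finset (Fin m))
      exact convexHull_mono (image_subset_range _ _) (mem_iInter.1 hw ⟨T₀, hT₀⟩)
    · intro A B hAB
      obtain ⟨T, hT, hside⟩ := exists_triangulation_one_sided A B
      refine cutForm_nonneg_of_mem_convexHull_image (fun p hp => ?_) (mem_iInter.1 hw ⟨T, hT⟩)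
      rcases hside _ (hf ⟨T, hT⟩) with h | h
      · exact h p hp
      -- The carrier of `z` is on the nonpositive side but `z` is not below the cut, so the cut
      -- contains the whole carrier.
      · have h0 : ∀ q ∈ Finset.univ,
            c ⟨T, hT⟩ q * cutForm A B (productVertex n m q) ≤ 0 := by
          intro q _
          by_cases hq : q ∈ f ⟨T, hT⟩
          · exact mul_nonpos_of_nonneg_of_nonpos (hcpos ⟨T, hT⟩ q hq).le (h q hq)
          · rw [hc0 ⟨T, hT⟩ q hq, zero_mul]
        have hsum : cutForm A B z = ∑ q, c ⟨T, hT⟩ q * cutForm A B (productVertex n m q) := by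
          conv_lhs => rw [← hcz ⟨T, hT⟩]
          simp [map_sum]
        have h1 := (Finset.sum_eq_zero_iff_of_nonpos h0).1
          (le_antisymm (Finset.sum_nonpos h0) (hsum ▸ hAB)) p (Finset.mem_univ p)
        exact ((mul_eq_zero.1 h1).resolve_left (hcpos ⟨T, hT⟩ p hp).ne').ge

end Cells

/-! ### The hyperplanes of cuts -/

section CutPlanes

variable {n m : ℕ}

/-- The hyperplane `x(A) = y(B)` of the affine hull `∑ x = ∑ y = 1` of the product of simplices. (For
`A = B = ∅` this is the affine hull itself.) -/
def cutPlane (A : Finset (Fin n)) (B : Finset (Fin m)) :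
    AffineSubspace ℝ ((Fin n → ℝ) × (Fin m → ℝ)) where
  carrier := {z | ∑ i, z.1 i = 1 ∧ ∑ j, z.2 j = 1 ∧ cutForm A B z = 0}
  smul_vsub_vadd_mem' := by
    rintro t p₁ p₂ p₃ ⟨a1, b1, c1⟩ ⟨a2, b2, c2⟩ ⟨a3, b3, c3⟩
    refine ⟨?_, ?_, ?_⟩
    · simp [Finset.sum_add_distrib, ← Finset.mul_sum, a1, a2, a3]
    · simp [Finset.sum_add_distrib, ← Finset.mul_sum, b1, b2, b3]
    · simp [c1, c2, c3]

theorem mem_cutPlane_iff {A : Finset (Fin n)} {B : Finset (Fin m)}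
    {z : (Fin n → ℝ) × (Fin m → ℝ)} :
    z ∈ cutPlane A B ↔ ∑ i, z.1 i = 1 ∧ ∑ j, z.2 j = 1 ∧ cutForm A B z = 0 := Iff.rfl

theorem productVertex_mem_cutPlane_iff {A : Finset (Fin n)} {B : Finset (Fin m)}
    {p : Fin n × Fin m} : productVertex n m p ∈ cutPlane A B ↔ (p.1 ∈ A ↔ p.2 ∈ B) := by
  rw [mem_cutPlane_iff, cutForm_productVertex_eq_zero_iff]
  simp [productVertex]

theorem mem_affineSpan_of_mem_span {S : Set (Fin n × Fin m)} {z : (Fin n → ℝ) × (Fin m → ℝ)}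
    (hz : z ∈ Submodule.span ℝ (productVertex n m '' S)) (h1 : ∑ i, z.1 i = 1) :
    z ∈ affineSpan ℝ (productVertex n m '' S) := by
  obtain ⟨c, c0, rfl⟩ := mem_span_image_iff_exists_sum.1 hz
  have hc : ∑ p, c p = 1 := (sum_eq_of_sum_smul_productVertex rfl).trans h1
  rw [← Finset.affineCombination_eq_linear_combination _ _ _ hc]
  exact affineCombination_mem_affineSpan_image hc (fun p _ hp => c0 p hp) _

theorem affineSpan_range_productVertex :
    affineSpan ℝ (range (productVertex n m)) = cutPlane ∅ ∅ := by
  refine le_antisymm (affineSpan_le.2 ?_) fun z hz => ?_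
  · rintro _ ⟨p, rfl⟩
    exact productVertex_mem_cutPlane_iff.2 (by simp)
  · obtain ⟨h1, h2, -⟩ := mem_cutPlane_iff.1 hz
    rw [← image_univ]
    exact mem_affineSpan_of_mem_span (mem_span_image_iff_exists_sum.2
      ⟨_, by simp, sum_mul_smul_productVertex h1 h2⟩) h1

theorem finrank_direction_cutPlane {A : Finset (Fin n)} {B : Finset (Fin m)} {p₀ p₁ : Fin n × Fin m}
    (h₀ : productVertex n m p₀ ∈ cutPlane A B) (h₁ : productVertex n m p₁ ∉ cutPlane A B) :
    Module.finrank ℝ (cutPlane A B).direction + 1 =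
      Module.finrank ℝ (vectorSpan ℝ (range (productVertex n m))) := by
  set W := vectorSpan ℝ (range (productVertex n m)) with hW
  have hWdir : W = (cutPlane (∅ : Finset (Fin n)) (∅ : Finset (Fin m))).direction := by
    rw [hW, ← direction_affineSpan, affineSpan_range_productVertex]
  have hmem : ∀ p, productVertex n m p ∈ cutPlane (∅ : Finset (Fin n)) (∅ : Finset (Fin m)) :=
    fun p => productVertex_mem_cutPlane_iff.2 (by simp)
  have hdir : (cutPlane A B).direction =
      (LinearMap.ker ((cutForm A B).domRestrict W)).map W.subtype := by
    ext x
    have hxW : x ∈ W ↔ x + productVertex n m p₀ ∈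
        cutPlane (∅ : Finset (Fin n)) (∅ : Finset (Fin m)) := by
      rw [hWdir]
      exact (AffineSubspace.vadd_mem_iff_mem_direction x (hmem p₀)).symm
    have hx0 : cutForm A B (x + productVertex n m p₀) = cutForm A B x := by
      rw [map_add, (mem_cutPlane_iff.1 h₀).2.2, add_zero]
    rw [← AffineSubspace.vadd_mem_iff_mem_direction x h₀, Submodule.mem_map, vadd_eq_add,
      mem_cutPlane_iff, hx0]
    rw [mem_cutPlane_iff] at hxW
    constructor
    · rintro ⟨a, b, c⟩
      exact ⟨⟨x, hxW.2 ⟨a, b, by simp [cutForm_apply]⟩⟩, c, rfl⟩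
    · rintro ⟨y, hy, rfl⟩
      obtain ⟨a, b, -⟩ := hxW.1 y.2
      exact ⟨a, b, hy⟩
  have hne : (cutForm A B).domRestrict W ≠ 0 := by
    intro h
    have hd : productVertex n m p₁ - productVertex n m p₀ ∈ W :=
      vsub_mem_vectorSpan ℝ ⟨p₁, rfl⟩ ⟨p₀, rfl⟩
    have h' := LinearMap.congr_fun h ⟨_, hd⟩
    rw [LinearMap.domRestrict_apply, map_sub, (mem_cutPlane_iff.1 h₀).2.2, sub_zero,
      LinearMap.zero_apply, cutForm_productVertex_eq_zero_iff] at h'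
    exact h₁ (productVertex_mem_cutPlane_iff.2 h')
  rw [hdir, Submodule.finrank_map_subtype_eq]
  exact Module.Dual.finrank_ker_add_one_of_ne_zero hne

end CutPlanes

/-! ### Two-component forests -/

section Forests

variable {n m : ℕ}

/-- If the connected components of a bipartite graph are `A ∪ B` and its complement, the edges span the
hyperplane `x(A) = y(B)`. -/
theorem edgeSpan_eq_cutPlane {F : SimpleGraph (Fin n ⊕ Fin m)}
    (hF : F ≤ completeBipartiteGraph (Fin n) (Fin m)) {A : Finset (Fin n)} {B : Finset (Fin m)}
    (h : ∀ x y, F.Reachable x y ↔ (Sum.elim (· ∈ A) (· ∈ B) x ↔ Sum.elim (· ∈ A) (· ∈ B) y)) :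
    edgeSpan F = cutPlane A B := by
  apply le_antisymm
  · refine affineSpan_le.2 ?_
    rintro _ ⟨p, hp, rfl⟩
    exact productVertex_mem_cutPlane_iff.2 ((h _ _).1 (SimpleGraph.Adj.reachable hp))
  · intro z hz
    obtain ⟨z1, z2, hz0⟩ := mem_cutPlane_iff.1 hz
    refine mem_affineSpan_of_mem_span ?_ z1
    by_contra hcon
    obtain ⟨A', B', hS, hne⟩ := exists_cutForm_ne_zero hcon
    apply hne
    have hreach : ∀ x y, F.Reachable x y →
        (Sum.elim (· ∈ A') (· ∈ B') x ↔ Sum.elim (· ∈ A') (· ∈ B') y) := by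
      rintro x y ⟨w⟩
      induction w with
      | nil => rfl
      | @cons u v _ huv _ ih =>
        refine Iff.trans ?_ ih
        have hb := hF huv
        rcases u with i | j <;> rcases v with i' | j'
        · simp at hb
        · exact cutForm_productVertex_eq_zero_iff.1 (hS (i, j') huv)
        · exact (cutForm_productVertex_eq_zero_iff.1 (hS (i', j) huv.symm)).symm
        · simp at hb
    -- `A' ∪ B'` is a union of components.
    have hconst : ∀ P : Fin n ⊕ Fin m → Prop, (∀ x y, P x → P y → F.Reachable x y) →
        (∀ x, P x → Sum.elim (· ∈ A') (· ∈ B') x) ∨ ∀ x, P x → ¬ Sum.elim (· ∈ A') (· ∈ B') x := by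
      intro P hP
      by_contra! hcon
      obtain ⟨⟨x, hx, hx'⟩, y, hy, hy'⟩ := hcon
      exact hx' ((hreach x y (hP x y hx hy)).2 hy')
    have hin := hconst (Sum.elim (· ∈ A) (· ∈ B)) fun x y hx hy => (h x y).2 (iff_of_true hx hy)
    have hout := hconst (fun x => ¬ Sum.elim (· ∈ A) (· ∈ B) x)
      fun x y hx hy => (h x y).2 (iff_of_false hx hy)
    simp only [Sum.forall, Sum.elim_inl, Sum.elim_inr] at hin hout
    rcases hin with ⟨i1, i2⟩ | ⟨i1, i2⟩ <;> rcases hout with ⟨o1, o2⟩ | ⟨o1, o2⟩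
    · have hA : A' = Finset.univ := Finset.eq_univ_iff_forall.2 fun i => by
        by_cases hi : i ∈ A
        exacts [i1 i hi, o1 i hi]
      have hB : B' = Finset.univ := Finset.eq_univ_iff_forall.2 fun i => by
        by_cases hi : i ∈ B
        exacts [i2 i hi, o2 i hi]
      rw [cutForm_apply, hA, hB, z1, z2, sub_self]
    · have hA : A' = A := Finset.ext fun i => ⟨not_imp_not.1 (o1 i), i1 i⟩
      have hB : B' = B := Finset.ext fun i => ⟨not_imp_not.1 (o2 i), i2 i⟩
      rw [hA, hB, hz0]
    · have hA : A' = Aᶜ := Finset.ext fun i => by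
        rw [Finset.mem_compl]; exact ⟨fun h h' => i1 i h' h, o1 i⟩
      have hB : B' = Bᶜ := Finset.ext fun i => by
        rw [Finset.mem_compl]; exact ⟨fun h h' => i2 i h' h, o2 i⟩
      rw [hA, hB, cutForm_compl z1 z2, hz0, neg_zero]
    · have hA : A' = ∅ := Finset.eq_empty_iff_forall_notMem.2 fun i => by
        by_cases hi : i ∈ A
        exacts [i1 i hi, o1 i hi]
      have hB : B' = ∅ := Finset.eq_empty_iff_forall_notMem.2 fun i => by
        by_cases hi : i ∈ B
        exacts [i2 i hi, o2 i hi]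
      rw [cutForm_apply, hA, hB, Finset.sum_empty, Finset.sum_empty, sub_self]

/-- The cuts `(A, B)` that properly intersect the polytope. -/
def IsProperCut (A : Finset (Fin n)) (B : Finset (Fin m)) : Prop :=
  (∃ i, i ∈ A) ∧ (∃ i, i ∉ A) ∧ (∃ j, j ∈ B) ∧ ∃ j, j ∉ B

theorem IsTwoComponentForest.exists_cutPlane {F : SimpleGraph (Fin n ⊕ Fin m)}
    (hF : IsTwoComponentForest F) : ∃ A B, IsProperCut A B ∧ edgeSpan F = cutPlane A B := by
  classical
  obtain ⟨hle, -, hcard, hadj⟩ := hF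
  obtain ⟨c₁, c₂, hne, hall⟩ := Nat.card_eq_two_iff.1 hcard
  have hcomp : ∀ c : F.ConnectedComponent, c ≠ c₁ → c = c₂ := by
    intro c hc
    have : c ∈ ({c₁, c₂} : Set F.ConnectedComponent) := hall ▸ mem_univ c
    exact this.resolve_left hc
  have hboth : ∀ c : F.ConnectedComponent, (∃ i, F.connectedComponentMk (Sum.inl i) = c) ∧
      ∃ j, F.connectedComponentMk (Sum.inr j) = c := by
    intro c
    induction c using SimpleGraph.ConnectedComponent.ind with
    | _ x =>
      obtain ⟨y, hxy⟩ := hadj x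
      have hb := hle hxy
      have hr := SimpleGraph.ConnectedComponent.eq.2 hxy.reachable.symm
      rcases x with i | j <;> rcases y with i' | j'
      · simp at hb
      · exact ⟨⟨i, rfl⟩, j', hr⟩
      · exact ⟨⟨i', hr⟩, j, rfl⟩
      · simp at hb
  refine ⟨Finset.univ.filter fun i => F.connectedComponentMk (Sum.inl i) = c₁,
    Finset.univ.filter fun j => F.connectedComponentMk (Sum.inr j) = c₁, ⟨?_, ?_, ?_, ?_⟩,
    edgeSpan_eq_cutPlane hle fun x y => ?_⟩
  · obtain ⟨i, hi⟩ := (hboth c₁).1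
    exact ⟨i, by simpa using hi⟩
  · obtain ⟨i, hi⟩ := (hboth c₂).1
    exact ⟨i, by simpa [hi] using hne.symm⟩
  · obtain ⟨i, hi⟩ := (hboth c₁).2
    exact ⟨i, by simpa using hi⟩
  · obtain ⟨i, hi⟩ := (hboth c₂).2
    exact ⟨i, by simpa [hi] using hne.symm⟩
  · have hside : ∀ x, Sum.elim (· ∈ Finset.univ.filter fun i =>
        F.connectedComponentMk (Sum.inl i) = c₁) (· ∈ Finset.univ.filter fun j =>
        F.connectedComponentMk (Sum.inr j) = c₁) x ↔ F.connectedComponentMk x = c₁ := by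
      rintro (i | j) <;> simp
    rw [hside, hside, ← SimpleGraph.ConnectedComponent.eq]
    constructor
    · intro h
      rw [h]
    · intro h
      by_cases hx : F.connectedComponentMk x = c₁
      · rw [hx, h.1 hx]
      · rw [hcomp _ hx, hcomp _ fun hy => hx (h.2 hy)]

theorem IsProperCut.exists_forest {A : Finset (Fin n)} {B : Finset (Fin m)}
    (hAB : IsProperCut A B) :
    ∃ F : SimpleGraph (Fin n ⊕ Fin m), IsTwoComponentForest F ∧ edgeSpan F = cutPlane A B := by
  obtain ⟨⟨i₁, hi₁⟩, ⟨i₀, hi₀⟩, ⟨j₁, hj₁⟩, ⟨j₀, hj₀⟩⟩ := hAB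
  let side : Fin n ⊕ Fin m → Prop := Sum.elim (· ∈ A) (· ∈ B)
  let G : SimpleGraph (Fin n ⊕ Fin m) :=
    { Adj := fun x y => (completeBipartiteGraph (Fin n) (Fin m)).Adj x y ∧ (side x ↔ side y)
      symm := ⟨fun _ _ h => ⟨h.1.symm, h.2.symm⟩⟩
      loopless := ⟨fun _ h => h.1.ne rfl⟩ }
  -- Every vertex is joined to the right vertex `j₁` or `j₀` that belongs to the same part.
  have hl : ∀ i, G.Reachable (Sum.inl i) (if i ∈ A then Sum.inr j₁ else Sum.inr j₀) := by
    intro i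
    apply SimpleGraph.Adj.reachable
    by_cases hi : i ∈ A <;> simp [G, side, hi, hj₁, hj₀]
  have hr : ∀ j, G.Reachable (Sum.inr j) (if j ∈ B then Sum.inr j₁ else Sum.inr j₀) := by
    intro j
    have h1 : G.Reachable (Sum.inr j) (if j ∈ B then Sum.inl i₁ else Sum.inl i₀) := by
      apply SimpleGraph.Adj.reachable
      by_cases hj : j ∈ B <;> simp [G, side, hj, hi₁, hi₀]
    refine h1.trans ?_
    by_cases hj : j ∈ B
    · simpa [hj, hi₁] using hl i₁
    · simpa [hj, hi₀] using hl i₀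
  have hto : ∀ x, (side x → G.Reachable x (Sum.inr j₁)) ∧ (¬ side x → G.Reachable x (Sum.inr j₀)) := by
    rintro (i | j)
    · exact ⟨fun h => by simpa [show i ∈ A from h] using hl i,
        fun h => by simpa [show i ∉ A from h] using hl i⟩
    · exact ⟨fun h => by simpa [show j ∈ B from h] using hr j,
        fun h => by simpa [show j ∉ B from h] using hr j⟩
  have hG : ∀ x y, G.Reachable x y ↔ (side x ↔ side y) := by
    intro x y
    constructor
    · rintro ⟨w⟩
      induction w with
      | nil => rfl
      | cons h _ ih => exact h.2.trans ih
    · intro h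
      by_cases hx : side x
      · exact ((hto x).1 hx).trans ((hto y).1 (h.1 hx)).symm
      · exact ((hto x).2 hx).trans ((hto y).2 fun hy => hx (h.2 hy)).symm
  obtain ⟨F, hFG, hac, hreach⟩ := G.exists_isAcyclic_reachable_eq_le
  have hF : ∀ x y, F.Reachable x y ↔ (side x ↔ side y) := fun x y => by rw [hreach, hG]
  have hle : F ≤ completeBipartiteGraph (Fin n) (Fin m) := fun x y h => (hFG h).1
  refine ⟨F, ⟨hle, hac, ?_, fun x => ?_⟩, edgeSpan_eq_cutPlane hle hF⟩
  · refine Nat.card_eq_two_iff.2 ⟨F.connectedComponentMk (Sum.inl i₁),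
      F.connectedComponentMk (Sum.inl i₀), fun h => ?_, eq_univ_of_forall fun c => ?_⟩
    · rw [SimpleGraph.ConnectedComponent.eq, hF] at h
      exact hi₀ (h.1 hi₁)
    · induction c using SimpleGraph.ConnectedComponent.ind with
      | _ x =>
        rw [mem_insert_iff, mem_singleton_iff, SimpleGraph.ConnectedComponent.eq,
          SimpleGraph.ConnectedComponent.eq, hF, hF]
        by_cases hx : side x
        · exact Or.inl (iff_of_true hx hi₁)
        · exact Or.inr (iff_of_false hx hi₀)
  · have hy : ∃ y, x ≠ y ∧ F.Reachable x y := by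
      simp only [hF]
      rcases x with i | j
      · by_cases hi : i ∈ A
        · exact ⟨Sum.inr j₁, by simp, iff_of_true hi hj₁⟩
        · exact ⟨Sum.inr j₀, by simp, iff_of_false hi hj₀⟩
      · by_cases hj : j ∈ B
        · exact ⟨Sum.inl i₁, by simp, iff_of_true hj hi₁⟩
        · exact ⟨Sum.inl i₀, by simp, iff_of_false hj hi₀⟩
    obtain ⟨y, hxy, ⟨w⟩⟩ := hy
    cases w with
    | nil => exact absurd rfl hxy
    | cons h _ => exact ⟨_, h⟩

end Forests

/-! ### Diagonal sections -/

section DiagonalSections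

variable {n m : ℕ}

theorem vectorSpan_convexHull_range_productVertex :
    vectorSpan ℝ (convexHull ℝ (range (productVertex n m))) =
      vectorSpan ℝ (range (productVertex n m)) := by
  rw [← direction_affineSpan, affineSpan_convexHull, direction_affineSpan]

/-- A hyperplane spanned by vertices is a cut, and a cut with the polytope on one side is the affine hull
of a facet. -/
theorem IsDiagonalSection.exists_cutPlane {H : AffineSubspace ℝ ((Fin n → ℝ) × (Fin m → ℝ))}
    (hH : IsDiagonalSection (productVertex n m) H) :
    ∃ A B, IsProperCut A B ∧ H = cutPlane A B := by
  obtain ⟨⟨S, ⟨p₀, hp₀⟩, hHS⟩, hdim, hfacet⟩ := hH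
  obtain ⟨p₁, hp₁⟩ : ∃ p, productVertex n m p ∉ Submodule.span ℝ (productVertex n m '' S) := by
    by_contra! hcon
    have hle : affineSpan ℝ (range (productVertex n m)) ≤ H := by
      rw [affineSpan_le, hHS]
      rintro _ ⟨p, rfl⟩
      exact mem_affineSpan_of_mem_span (hcon p) (by simp [productVertex])
    have := Submodule.finrank_mono (AffineSubspace.direction_le hle)
    rw [direction_affineSpan] at this
    omega
  obtain ⟨A, B, hS, hne⟩ := exists_cutForm_ne_zero hp₁
  have hle : H ≤ cutPlane A B := by
    rw [hHS]
    refine affineSpan_le.2 ?_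
    rintro _ ⟨p, hp, rfl⟩
    exact productVertex_mem_cutPlane_iff.2 (cutForm_productVertex_eq_zero_iff.1 (hS p hp))
  have hSH : ∀ p ∈ S, productVertex n m p ∈ H := fun p hp => by
    rw [hHS]; exact subset_affineSpan ℝ _ ⟨p, hp, rfl⟩
  have hdim' := finrank_direction_cutPlane (hle (hSH p₀ hp₀))
    (p₁ := p₁) fun h => hne (mem_cutPlane_iff.1 h).2.2
  have hHcut : H = cutPlane A B := AffineSubspace.eq_of_direction_eq_of_nonempty_of_le
    (Submodule.eq_of_le_of_finrank_eq (AffineSubspace.direction_le hle) (by omega))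
    ⟨_, hSH p₀ hp₀⟩ hle
  have key : ∀ l : StrongDual ℝ ((Fin n → ℝ) × (Fin m → ℝ)),
      (∀ z, l z = 0 ↔ cutForm A B z = 0) → (∀ p, l (productVertex n m p) ≤ 0) → False := by
    intro l hl hle0
    have hP : ∀ z ∈ convexHull ℝ (range (productVertex n m)), l z ≤ 0 := by
      refine fun z hz => convexHull_min (t := {z | l z ≤ 0}) ?_ ?_ hz
      · rintro _ ⟨p, rfl⟩
        exact hle0 p
      · exact convex_halfSpace_le l.toLinearMap.isLinear 0
    have hSP : ∀ p, productVertex n m p ∈ convexHull ℝ (range (productVertex n m)) :=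
      fun p => subset_convexHull ℝ _ ⟨p, rfl⟩
    have hl0 : ∀ p ∈ S, l (productVertex n m p) = 0 := fun p hp => (hl _).2 (hS p hp)
    have hspan : H = affineSpan ℝ {z ∈ convexHull ℝ (range (productVertex n m)) | l z = 0} := by
      apply le_antisymm
      · rw [hHS]
        refine affineSpan_mono ℝ ?_
        rintro _ ⟨p, hp, rfl⟩
        exact ⟨hSP p, hl0 p hp⟩
      · rw [hHcut, affineSpan_le]
        rintro z ⟨hz, hz0⟩
        obtain ⟨⟨-, z1⟩, -, z2⟩ := mem_convexHull_productVertex_iff.1 hz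
        exact mem_cutPlane_iff.2 ⟨z1, z2, (hl z).1 hz0⟩
    refine hfacet {z ∈ convexHull ℝ (range (productVertex n m)) | l z = 0}
      ⟨⟨productVertex n m p₀, hSP p₀, hl0 p₀ hp₀⟩, fun _ => ⟨l, ?_⟩, ?_⟩ hspan
    · ext z
      refine and_congr_right fun hz => ⟨fun h y hy => h ▸ hP y hy, fun h => ?_⟩
      exact le_antisymm (hP z hz) (hl0 p₀ hp₀ ▸ h _ (hSP p₀))
    · rw [vectorSpan_convexHull_range_productVertex, ← hdim, ← direction_affineSpan, ← hspan]
  have hpos : ¬ ∀ p, 0 ≤ cutForm A B (productVertex n m p) := fun h =>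
    key (-LinearMap.toContinuousLinearMap (cutForm A B)) (fun z => by simp)
      fun p => by simpa using h p
  have hneg : ¬ ∀ p, cutForm A B (productVertex n m p) ≤ 0 := fun h =>
    key (LinearMap.toContinuousLinearMap (cutForm A B)) (fun z => by simp) fun p => by simpa using h p
  simp only [cutForm_productVertex] at hpos hneg
  refine ⟨A, B, ⟨?_, ?_, ?_, ?_⟩, hHcut⟩ <;> by_contra! hcon
  · refine hneg fun p => ?_
    rw [if_neg (hcon p.1)]
    split_ifs <;> norm_num
  · refine hpos fun p => ?_
    rw [if_pos (hcon p.1)]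
    split_ifs <;> norm_num
  · refine hpos fun p => ?_
    rw [if_neg (hcon p.2)]
    split_ifs <;> norm_num
  · refine hneg fun p => ?_
    rw [if_pos (hcon p.2)]
    split_ifs <;> norm_num

theorem IsProperCut.isDiagonalSection {A : Finset (Fin n)} {B : Finset (Fin m)}
    (hAB : IsProperCut A B) : IsDiagonalSection (productVertex n m) (cutPlane A B) := by
  obtain ⟨F, hF, hspan⟩ := hAB.exists_forest
  obtain ⟨⟨i₁, hi₁⟩, ⟨i₀, hi₀⟩, ⟨j₁, hj₁⟩, ⟨j₀, hj₀⟩⟩ := hAB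
  have hdim := finrank_direction_cutPlane (A := A) (B := B) (p₀ := (i₁, j₁)) (p₁ := (i₁, j₀))
    (productVertex_mem_cutPlane_iff.2 (iff_of_true hi₁ hj₁))
    fun h => hj₀ ((productVertex_mem_cutPlane_iff.1 h).1 hi₁)
  refine ⟨⟨_, ?_, hspan.symm⟩, hdim, ?_⟩
  · obtain ⟨x, hx⟩ := hF.2.2.2 (Sum.inl i₁)
    rcases x with i | j
    · simpa using hF.1 hx
    · exact ⟨(i₁, j), hx⟩
  · rintro F' ⟨⟨x₀, hx₀⟩, hexp, hcodim⟩ hF'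
    obtain ⟨l, hl⟩ := hexp ⟨x₀, hx₀⟩
    have hmax : ∀ y ∈ convexHull ℝ (range (productVertex n m)), l y ≤ l x₀ := by
      rw [hl] at hx₀
      exact hx₀.2
    have hconst : ∀ z ∈ cutPlane A B, l z = l x₀ := by
      have hle : affineSpan ℝ F' ≤ AffineSubspace.mk' x₀ (LinearMap.ker l.toLinearMap) := by
        refine affineSpan_le.2 fun z hz => ?_
        have hz' := hz
        rw [hl] at hz'
        have : l z = l x₀ := le_antisymm (hmax z hz'.1) (hz'.2 x₀ (hexp.subset hx₀))
        rw [SetLike.mem_coe, AffineSubspace.mem_mk', LinearMap.mem_ker]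
        simp [this]
      intro z hz
      rw [hF'] at hz
      have := hle hz
      rw [AffineSubspace.mem_mk', LinearMap.mem_ker] at this
      simpa [sub_eq_zero] using this
    have hvert : ∀ p, productVertex n m p ∈ convexHull ℝ (range (productVertex n m)) :=
      fun p => subset_convexHull ℝ _ ⟨p, rfl⟩
    -- The functional is constant on the two diagonal blocks; the circuit through one vertex of each
    -- block shows that it is constant on the remaining vertices as well.
    have hswap : ∀ i j i' j', (i ∈ A ↔ j' ∈ B) → (i' ∈ A ↔ j ∈ B) →
        l (productVertex n m (i, j)) = l x₀ := by
      intro i j i' j' h1 h2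
      have e1 := hconst (productVertex n m (i, j')) (productVertex_mem_cutPlane_iff.2 h1)
      have e2 := hconst (productVertex n m (i', j)) (productVertex_mem_cutPlane_iff.2 h2)
      have e3 : l (productVertex n m (i, j)) + l (productVertex n m (i', j')) =
          l (productVertex n m (i, j')) + l (productVertex n m (i', j)) := by
        rw [← map_add, ← map_add]
        simp [productVertex, add_comm]
      linarith [hmax _ (hvert (i, j)), hmax _ (hvert (i', j'))]
    have hall : ∀ p, l (productVertex n m p) = l x₀ := by
      rintro ⟨i, j⟩
      obtain ⟨j', hj'⟩ : ∃ j', i ∈ A ↔ j' ∈ B := by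
        by_cases hi : i ∈ A
        · exact ⟨j₁, iff_of_true hi hj₁⟩
        · exact ⟨j₀, iff_of_false hi hj₀⟩
      obtain ⟨i', hi'⟩ : ∃ i', i' ∈ A ↔ j ∈ B := by
        by_cases hj : j ∈ B
        · exact ⟨i₁, iff_of_true hi₁ hj⟩
        · exact ⟨i₀, iff_of_false hi₀ hj⟩
      exact hswap i j i' j' hj' hi'
    have hge : ∀ z ∈ convexHull ℝ (range (productVertex n m)), l x₀ ≤ l z := by
      refine fun z hz => convexHull_min (t := {z | l x₀ ≤ l z}) ?_ ?_ hz
      · rintro _ ⟨p, rfl⟩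
        exact (hall p).ge
      · exact convex_halfSpace_ge l.toLinearMap.isLinear _
    have hFP : F' = convexHull ℝ (range (productVertex n m)) := by
      rw [hl]
      exact subset_antisymm (fun z hz => hz.1) fun z hz =>
        ⟨hz, fun y hy => (hmax y hy).trans (hge z hz)⟩
    rw [hFP] at hcodim
    omega

theorem isDiagonalSection_iff_exists_forest {H : AffineSubspace ℝ ((Fin n → ℝ) × (Fin m → ℝ))} :
    IsDiagonalSection (productVertex n m) H ↔
      ∃ F : SimpleGraph (Fin n ⊕ Fin m), IsTwoComponentForest F ∧ H = edgeSpan F := by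
  constructor
  · intro hH
    obtain ⟨A, B, hAB, rfl⟩ := hH.exists_cutPlane
    obtain ⟨F, hF, h⟩ := hAB.exists_forest
    exact ⟨F, hF, h.symm⟩
  · rintro ⟨F, hF, rfl⟩
    obtain ⟨A, B, hAB, h⟩ := hF.exists_cutPlane
    rw [h]
    exact hAB.isDiagonalSection

/-- The sides of a cut are given by the sign of the cut functional. -/
theorem wSameSide_cutPlane_iff {A : Finset (Fin n)} {B : Finset (Fin m)}
    {p q p₀ : (Fin n → ℝ) × (Fin m → ℝ)} (hp₀ : p₀ ∈ cutPlane A B)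
    (hp : p ∈ convexHull ℝ (range (productVertex n m)))
    (hq : q ∈ convexHull ℝ (range (productVertex n m))) (hpH : p ∉ cutPlane A B) :
    (cutPlane A B).WSameSide p q ↔ 0 ≤ cutForm A B p * cutForm A B q := by
  obtain ⟨⟨-, p1⟩, -, p2⟩ := mem_convexHull_productVertex_iff.1 hp
  obtain ⟨⟨-, q1⟩, -, q2⟩ := mem_convexHull_productVertex_iff.1 hq
  obtain ⟨a1, a2, a3⟩ := mem_cutPlane_iff.1 hp₀
  constructor
  · rintro ⟨x, hx, y, hy, h⟩
    have h' := h.map (cutForm A B)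
    rw [vsub_eq_sub, vsub_eq_sub, map_sub, map_sub, (mem_cutPlane_iff.1 hx).2.2,
      (mem_cutPlane_iff.1 hy).2.2, sub_zero, sub_zero] at h'
    rcases h' with h' | h' | ⟨r, s, hr, hs, h'⟩
    · simp [h']
    · simp [h']
    · simp only [smul_eq_mul] at h'
      rw [← mul_nonneg_iff_of_pos_left hs, show s * (cutForm A B p * cutForm A B q) =
        cutForm A B p * (s * cutForm A B q) by ring, ← h']
      nlinarith [mul_nonneg hr.le (mul_self_nonneg (cutForm A B p))]
  · intro h
    have hp0 : cutForm A B p ≠ 0 := fun h => hpH (mem_cutPlane_iff.2 ⟨p1, p2, h⟩)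
    have hr : 0 ≤ cutForm A B q / cutForm A B p := by
      rw [← mul_div_mul_left _ _ hp0]
      exact div_nonneg h (mul_self_nonneg _)
    refine AffineSubspace.wSameSide_of_vsub_eq_smul (m := p - p₀) (c₁ := 1)
      (c₂ := cutForm A B q / cutForm A B p) hp₀
      (p₂ := q - (cutForm A B q / cutForm A B p) • (p - p₀)) ?_ (by simp) (by simp) (by simpa using hr)
    refine mem_cutPlane_iff.2 ⟨?_, ?_, ?_⟩
    · simp [Finset.sum_sub_distrib, ← Finset.mul_sum, p1, q1, a1]
    · simp [Finset.sum_sub_distrib, ← Finset.mul_sum, p2, q2, a2]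
    · simp [a3, hp0]

end DiagonalSections

/-! ### The diagonal section complex is the subdivision by cuts -/

section DiagonalSectionComplex

variable {n m : ℕ}

/-- The minimal face containing a point of the polytope is determined by the support of the point,
because the point is the barycenter of all vertices of that face with positive weights. -/
theorem cutCell_subset_of_isExposed {F : Set ((Fin n → ℝ) × (Fin m → ℝ))}
    (hF : IsExposed ℝ (convexHull ℝ (range (productVertex n m))) F)
    {z : (Fin n → ℝ) × (Fin m → ℝ)} (hz : z ∈ F) : cutCell z ⊆ F := by
  intro w hw
  have hzP := hF.subset hz
  obtain ⟨⟨z0, z1⟩, z0', z2⟩ := mem_convexHull_productVertex_iff.1 hzP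
  obtain ⟨⟨w0, w1⟩, w0', w2⟩ := mem_convexHull_productVertex_iff.1 hw.1
  obtain ⟨l, rfl⟩ := hF ⟨z, hz⟩
  have hrow : ∀ i, z.1 i = 0 → w.1 i = 0 := by
    intro i hi
    have := cutForm_eq_zero_of_mem_cutCell hzP hw (A := {i}) (B := ∅) (by simp [cutForm_apply, hi])
    simpa [cutForm_apply] using this
  have hcol : ∀ j, z.2 j = 0 → w.2 j = 0 := by
    intro j hj
    have := cutForm_eq_zero_of_mem_cutCell hzP hw (A := ∅) (B := {j}) (by simp [cutForm_apply, hj])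
    simpa [cutForm_apply] using this
  have hval : ∀ u : (Fin n → ℝ) × (Fin m → ℝ), ∑ i, u.1 i = 1 → ∑ j, u.2 j = 1 →
      l z - l u = ∑ p, (u.1 p.1 * u.2 p.2) * (l z - l (productVertex n m p)) := by
    intro u u1 u2
    have h1 : ∑ p : Fin n × Fin m, u.1 p.1 * u.2 p.2 = 1 := by
      rw [sum_eq_of_sum_smul_productVertex (sum_mul_smul_productVertex u1 u2), u1]
    have h2 : l u = ∑ p, (u.1 p.1 * u.2 p.2) * l (productVertex n m p) := by
      conv_lhs => rw [← sum_mul_smul_productVertex u1 u2]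
      simp [map_sum]
    simp only [mul_sub, Finset.sum_sub_distrib]
    rw [← Finset.sum_mul, h1, one_mul, h2]
  have hzero := hval z z1 z2
  rw [sub_self, eq_comm, Finset.sum_eq_zero_iff_of_nonneg fun p _ => mul_nonneg
    (mul_nonneg (z0 _) (z0' _)) (sub_nonneg.2 (hz.2 _ (subset_convexHull ℝ _ ⟨p, rfl⟩)))] at hzero
  have hlw : l z - l w = 0 := by
    rw [hval w w1 w2]
    refine Finset.sum_eq_zero fun p hp => ?_
    rcases mul_eq_zero.1 (hzero p hp) with h | h
    · rcases mul_eq_zero.1 h with h | h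
      · rw [hrow _ h, zero_mul, zero_mul]
      · rw [hcol _ h, mul_zero, zero_mul]
    · rw [h, mul_zero]
  exact ⟨hw.1, fun y hy => (hz.2 y hy).trans (by linarith)⟩

/-- Within the polytope, the pieces of a cut are given by conditions on the cut functional. -/
theorem IsHyperplanePiece.mem_iff {A : Finset (Fin n)} {B : Finset (Fin m)}
    {D : Set ((Fin n → ℝ) × (Fin m → ℝ))} (hAB : IsProperCut A B)
    (hD : IsHyperplanePiece (convexHull ℝ (range (productVertex n m))) (cutPlane A B) D) :
    (∀ w ∈ convexHull ℝ (range (productVertex n m)), w ∈ D ↔ cutForm A B w = 0) ∨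
      ∃ t, t ≠ 0 ∧ ∀ w ∈ convexHull ℝ (range (productVertex n m)), w ∈ D ↔ 0 ≤ t * cutForm A B w := by
  rcases hD with rfl | ⟨p, hp, hpH, rfl⟩
  · refine Or.inl fun w hw => ?_
    obtain ⟨⟨-, w1⟩, -, w2⟩ := mem_convexHull_productVertex_iff.1 hw
    exact ⟨fun h => (mem_cutPlane_iff.1 h).2.2, fun h => mem_cutPlane_iff.2 ⟨w1, w2, h⟩⟩
  · obtain ⟨⟨i, hi⟩, -, ⟨j, hj⟩, -⟩ := hAB
    obtain ⟨⟨-, p1⟩, -, p2⟩ := mem_convexHull_productVertex_iff.1 hp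
    exact Or.inr ⟨cutForm A B p, fun h => hpH (mem_cutPlane_iff.2 ⟨p1, p2, h⟩), fun w hw =>
      wSameSide_cutPlane_iff (p₀ := productVertex n m (i, j))
      (productVertex_mem_cutPlane_iff.2 (iff_of_true hi hj)) hp hw hpH⟩

theorem cutCell_subset_piece {A : Finset (Fin n)} {B : Finset (Fin m)}
    {D : Set ((Fin n → ℝ) × (Fin m → ℝ))} (hAB : IsProperCut A B)
    (hD : IsHyperplanePiece (convexHull ℝ (range (productVertex n m))) (cutPlane A B) D)
    {z : (Fin n → ℝ) × (Fin m → ℝ)} (hz : z ∈ convexHull ℝ (range (productVertex n m)))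
    (hzD : z ∈ D) : cutCell z ⊆ D := by
  intro w hw
  rcases hD.mem_iff hAB with h | ⟨t, ht0, h⟩
  · rw [h w hw.1]
    exact cutForm_eq_zero_of_mem_cutCell hz hw ((h z hz).1 hzD)
  · rw [h w hw.1]
    rw [h z hz] at hzD
    obtain ⟨⟨-, z1⟩, -, z2⟩ := mem_convexHull_productVertex_iff.1 hz
    obtain ⟨⟨-, w1⟩, -, w2⟩ := mem_convexHull_productVertex_iff.1 hw.1
    rcases ht0.lt_or_gt with ht | ht
    · have h1 := hw.2 Aᶜ Bᶜ (by rw [cutForm_compl z1 z2]; nlinarith)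
      rw [cutForm_compl w1 w2] at h1
      nlinarith
    · exact mul_nonneg ht.le (hw.2 A B (nonneg_of_mul_nonneg_right hzD ht))

theorem IsHyperplanePiece.convex_inter {A : Finset (Fin n)} {B : Finset (Fin m)}
    {D : Set ((Fin n → ℝ) × (Fin m → ℝ))} (hAB : IsProperCut A B)
    (hD : IsHyperplanePiece (convexHull ℝ (range (productVertex n m))) (cutPlane A B) D) :
    Convex ℝ (convexHull ℝ (range (productVertex n m)) ∩ D) := by
  have hconv := convex_convexHull ℝ (range (productVertex n m))
  rcases hD.mem_iff hAB with h | ⟨t, -, h⟩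
  · have : convexHull ℝ (range (productVertex n m)) ∩ D =
        convexHull ℝ (range (productVertex n m)) ∩ {w | cutForm A B w = 0} :=
      Set.ext fun w => and_congr_right (h w)
    rw [this]
    exact hconv.inter (convex_hyperplane (cutForm A B).isLinear 0)
  · have : convexHull ℝ (range (productVertex n m)) ∩ D =
        convexHull ℝ (range (productVertex n m)) ∩ {w | 0 ≤ (t • cutForm A B) w} :=
      Set.ext fun w => and_congr_right (h w)
    rw [this]
    exact hconv.inter (convex_halfSpace_ge (t • cutForm A B).isLinear 0)

theorem IsHyperplanePiece.one_sided {A : Finset (Fin n)} {B : Finset (Fin m)}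
    {D : Set ((Fin n → ℝ) × (Fin m → ℝ))} (hAB : IsProperCut A B)
    (hD : IsHyperplanePiece (convexHull ℝ (range (productVertex n m))) (cutPlane A B) D) :
    (∀ w ∈ convexHull ℝ (range (productVertex n m)), w ∈ D → 0 ≤ cutForm A B w) ∨
      ∀ w ∈ convexHull ℝ (range (productVertex n m)), w ∈ D → cutForm A B w ≤ 0 := by
  rcases hD.mem_iff hAB with h | ⟨t, ht0, h⟩
  · exact Or.inl fun w hw hwD => ((h w hw).1 hwD).ge
  · rcases ht0.lt_or_gt with ht | ht
    · exact Or.inr fun w hw hwD => nonpos_of_mul_nonneg_right ((h w hw).1 hwD) ht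
    · exact Or.inl fun w hw hwD => nonneg_of_mul_nonneg_right ((h w hw).1 hwD) ht

/-- A cut that is not proper is nonnegative or nonpositive on the polytope; in the second case its
sign at a point depends only on the support of the point. -/
theorem cutForm_of_not_isProperCut {A : Finset (Fin n)} {B : Finset (Fin m)}
    (hAB : ¬ IsProperCut A B) :
    (∀ w ∈ convexHull ℝ (range (productVertex n m)), 0 ≤ cutForm A B w) ∨
      ((∀ w ∈ convexHull ℝ (range (productVertex n m)), cutForm A B w ≤ 0) ∧
        ∀ z ∈ convexHull ℝ (range (productVertex n m)),
          ∀ w ∈ convexHull ℝ (range (productVertex n m)), (∀ i, z.1 i = 0 → w.1 i = 0) →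
            (∀ j, z.2 j = 0 → w.2 j = 0) → 0 ≤ cutForm A B z → 0 ≤ cutForm A B w) := by
  have hP := fun w => (mem_convexHull_productVertex_iff (n := n) (m := m) (z := w)).1
  by_cases h1 : ∃ i, i ∈ A
  · by_cases h2 : ∃ i, i ∉ A
    · by_cases h3 : ∃ j, j ∈ B
      · by_cases h4 : ∃ j, j ∉ B
        · exact absurd ⟨h1, h2, h3, h4⟩ hAB
        · push Not at h4
          have hval : ∀ w ∈ convexHull ℝ (range (productVertex n m)),
              cutForm A B w = - ∑ i ∈ Aᶜ, w.1 i := by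
            intro w hw
            obtain ⟨⟨w0, w1⟩, w0', w2⟩ := hP w hw
            rw [cutForm_apply, Finset.eq_univ_iff_forall.2 h4, w2, ← w1,
              ← Finset.sum_add_sum_compl A w.1]
            ring
          refine Or.inr ⟨fun w hw => ?_, fun z hz w hw hrow _ h => ?_⟩
          · rw [hval w hw, neg_nonpos]
            exact Finset.sum_nonneg fun i _ => (hP w hw).1.1 i
          · rw [hval z hz, neg_nonneg] at h
            have h0 := (Finset.sum_eq_zero_iff_of_nonneg fun i _ => (hP z hz).1.1 i).1
              (le_antisymm h (Finset.sum_nonneg fun i _ => (hP z hz).1.1 i))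
            rw [hval w hw, Finset.sum_eq_zero fun i hi => hrow i (h0 i hi), neg_zero]
      · push Not at h3
        refine Or.inl fun w hw => ?_
        rw [cutForm_apply, Finset.eq_empty_iff_forall_notMem.2 h3, Finset.sum_empty, sub_zero]
        exact Finset.sum_nonneg fun i _ => (hP w hw).1.1 i
    · push Not at h2
      refine Or.inl fun w hw => ?_
      rw [cutForm_apply, Finset.eq_univ_iff_forall.2 h2, (hP w hw).1.2, ← (hP w hw).2.2, sub_nonneg]
      exact Finset.sum_le_sum_of_subset_of_nonneg (Finset.subset_univ B)
        fun j _ _ => (hP w hw).2.1 j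
  · push Not at h1
    have hval : ∀ w, cutForm A B w = - ∑ j ∈ B, w.2 j := fun w => by
      rw [cutForm_apply, Finset.eq_empty_iff_forall_notMem.2 h1, Finset.sum_empty, zero_sub]
    refine Or.inr ⟨fun w hw => ?_, fun z hz w hw _ hcol h => ?_⟩
    · rw [hval, neg_nonpos]
      exact Finset.sum_nonneg fun j _ => (hP w hw).2.1 j
    · rw [hval, neg_nonneg] at h
      have h0 := (Finset.sum_eq_zero_iff_of_nonneg fun j _ => (hP z hz).2.1 j).1
        (le_antisymm h (Finset.sum_nonneg fun j _ => (hP z hz).2.1 j))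
      rw [hval, Finset.sum_eq_zero fun j hj => hcol j (h0 j hj), neg_zero]

/-- Every point of the polytope lies in an exposed face all of whose points have their support contained
in the support of the given point. -/
theorem exists_isExposed_support {z : (Fin n → ℝ) × (Fin m → ℝ)}
    (hz : z ∈ convexHull ℝ (range (productVertex n m))) :
    ∃ F, IsExposed ℝ (convexHull ℝ (range (productVertex n m))) F ∧ z ∈ F ∧
      ∀ w ∈ F, (∀ i, z.1 i = 0 → w.1 i = 0) ∧ ∀ j, z.2 j = 0 → w.2 j = 0 := by
  classical
  let I : Finset (Fin n) := Finset.univ.filter fun i => z.1 i = 0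
  let J : Finset (Fin m) := Finset.univ.filter fun j => z.2 j = 0
  let l : StrongDual ℝ ((Fin n → ℝ) × (Fin m → ℝ)) :=
    LinearMap.toContinuousLinearMap (cutForm ∅ J - cutForm I ∅)
  have hl : ∀ w, l w = - (∑ i ∈ I, w.1 i + ∑ j ∈ J, w.2 j) := by
    intro w
    simp only [l, LinearMap.coe_toContinuousLinearMap', LinearMap.sub_apply, cutForm_apply,
      Finset.sum_empty]
    ring
  have hlz : l z = 0 := by
    rw [hl, Finset.sum_eq_zero fun i hi => (Finset.mem_filter.1 hi).2,
      Finset.sum_eq_zero fun j hj => (Finset.mem_filter.1 hj).2, add_zero, neg_zero]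
  refine ⟨l.toExposed (convexHull ℝ (range (productVertex n m))),
    ContinuousLinearMap.toExposed.isExposed, ⟨hz, fun y hy => ?_⟩, fun w hw => ?_⟩
  · obtain ⟨⟨y0, -⟩, y0', -⟩ := mem_convexHull_productVertex_iff.1 hy
    rw [hlz, hl, neg_nonpos]
    exact add_nonneg (Finset.sum_nonneg fun i _ => y0 i) (Finset.sum_nonneg fun j _ => y0' j)
  · obtain ⟨⟨w0, -⟩, w0', -⟩ := mem_convexHull_productVertex_iff.1 hw.1
    have h := hw.2 z hz
    rw [hlz, hl] at h
    have hI := Finset.sum_nonneg fun i (_ : i ∈ I) => w0 i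
    have hJ := Finset.sum_nonneg fun j (_ : j ∈ J) => w0' j
    exact ⟨fun i hi => (Finset.sum_eq_zero_iff_of_nonneg fun i _ => w0 i).1
        (show ∑ i ∈ I, w.1 i = 0 by linarith) i (Finset.mem_filter.2 ⟨Finset.mem_univ i, hi⟩),
      fun j hj => (Finset.sum_eq_zero_iff_of_nonneg fun j _ => w0' j).1
        (show ∑ j ∈ J, w.2 j = 0 by linarith) j (Finset.mem_filter.2 ⟨Finset.mem_univ j, hj⟩)⟩

theorem diagonalSectionComplex_productVertex :
    diagonalSectionComplex (productVertex n m) =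
      {C | ∃ z ∈ convexHull ℝ (range (productVertex n m)), C = cutCell z} := by
  classical
  ext C
  constructor
  · rintro ⟨hne, F, hF, s, hs, rfl⟩
    have hrw : F ∩ ⋂ H, s H = F ∩ ⋂ H, (convexHull ℝ (range (productVertex n m)) ∩ s H) := by
      ext w
      simp only [mem_inter_iff, mem_iInter]
      exact and_congr_right fun hw => forall_congr' fun H =>
        ⟨fun h => ⟨hF.subset hw, h⟩, fun h => h.2⟩
    have hconv : Convex ℝ (F ∩ ⋂ H, s H) := by
      rw [hrw]
      refine (hF.convex (convex_convexHull ℝ _)).inter (convex_iInter fun H => ?_)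
      obtain ⟨A, B, hAB, h⟩ := H.2.exists_cutPlane
      exact IsHyperplanePiece.convex_inter hAB (h ▸ hs H)
    obtain ⟨z, hz, hcell⟩ := exists_subset_cutCell hconv hne
      (inter_subset_left.trans hF.subset) fun A B => by
        by_cases hAB : IsProperCut A B
        · refine (IsHyperplanePiece.one_sided hAB
            (hs ⟨_, hAB.isDiagonalSection⟩)).imp ?_ ?_ <;>
          exact fun h w hw => h w (hF.subset hw.1) (mem_iInter.1 hw.2 _)
        · exact (cutForm_of_not_isProperCut hAB).imp (fun h w hw => h w (hF.subset hw.1))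
            fun h w hw => h.1 w (hF.subset hw.1)
    refine ⟨z, hF.subset hz.1, subset_antisymm hcell (subset_inter
      (cutCell_subset_of_isExposed hF hz.1) (subset_iInter fun H => ?_))⟩
    obtain ⟨A, B, hAB, h⟩ := H.2.exists_cutPlane
    exact cutCell_subset_piece hAB (h ▸ hs H) (hF.subset hz.1) (mem_iInter.1 hz.2 H)
  · rintro ⟨z, hz, rfl⟩
    obtain ⟨F, hF, hzF, hsupp⟩ := exists_isExposed_support hz
    let s : {H : AffineSubspace ℝ ((Fin n → ℝ) × (Fin m → ℝ)) //
        IsDiagonalSection (productVertex n m) H} → Set ((Fin n → ℝ) × (Fin m → ℝ)) :=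
      fun H => if z ∈ H.1 then (H.1 : Set _) else {q | H.1.WSameSide z q}
    have hs : ∀ H, IsHyperplanePiece (convexHull ℝ (range (productVertex n m))) H.1 (s H) := by
      intro H
      by_cases hH : z ∈ H.1
      · exact Or.inl (if_pos hH)
      · exact Or.inr ⟨z, hz, hH, if_neg hH⟩
    have hzs : ∀ H, z ∈ s H := by
      intro H
      by_cases hH : z ∈ H.1
      · simp only [s, if_pos hH]
        exact hH
      · obtain ⟨A, B, ⟨⟨i, hi⟩, -, ⟨j, hj⟩, -⟩, h⟩ := H.2.exists_cutPlane
        simp only [s, if_neg hH, mem_ofPred_eq]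
        rw [AffineSubspace.wSameSide_self_iff, h]
        exact ⟨productVertex n m (i, j), productVertex_mem_cutPlane_iff.2 (iff_of_true hi hj)⟩
    refine ⟨⟨z, self_mem_cutCell hz⟩, F, hF, s, hs, subset_antisymm (subset_inter
      (cutCell_subset_of_isExposed hF hzF) (subset_iInter fun H => ?_)) fun w hw => ?_⟩
    · obtain ⟨A, B, hAB, h⟩ := H.2.exists_cutPlane
      exact cutCell_subset_piece hAB (h ▸ hs H) hz (hzs H)
    · have hwP := hF.subset hw.1
      obtain ⟨⟨-, z1⟩, -, z2⟩ := mem_convexHull_productVertex_iff.1 hz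
      refine ⟨hwP, fun A B h => ?_⟩
      by_cases hAB : IsProperCut A B
      · have hwH := mem_iInter.1 hw.2 ⟨_, hAB.isDiagonalSection⟩
        by_cases hH : z ∈ cutPlane A B
        · simp only [s, if_pos hH] at hwH
          exact (mem_cutPlane_iff.1 hwH).2.2.ge
        · simp only [s, if_neg hH, mem_ofPred_eq] at hwH
          obtain ⟨⟨i, hi⟩, -, ⟨j, hj⟩, -⟩ := hAB
          rw [wSameSide_cutPlane_iff (p₀ := productVertex n m (i, j))
            (productVertex_mem_cutPlane_iff.2 (iff_of_true hi hj)) hz hwP hH] at hwH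
          exact nonneg_of_mul_nonneg_right hwH
            (h.lt_of_ne fun h0 => hH (mem_cutPlane_iff.2 ⟨z1, z2, h0.symm⟩))
      · rcases cutForm_of_not_isProperCut hAB with h' | ⟨-, h'⟩
        · exact h' w hwP
        · exact h' z hz w hwP (hsupp w hw.1).1 (hsupp w hw.1).2 h

end DiagonalSectionComplex

theorem mainTheorem3 :
    (∀ n m : ℕ, 1 ≤ n → 1 ≤ m →
      chamberComplex (productVertex n m) = diagonalSectionComplex (productVertex n m) ∧
      ∀ H : AffineSubspace ℝ ((Fin n → ℝ) × (Fin m → ℝ)),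
        IsDiagonalSection (productVertex n m) H ↔
          ∃ F : SimpleGraph (Fin n ⊕ Fin m), IsTwoComponentForest F ∧ H = edgeSpan F) ∧
    (∀ n m : ℕ, 2 ≤ n → 2 ≤ m → 7 ≤ n + m →
      ∃ C : Set (Finset (Fin n × Fin m)), IsVirtualChamber (productVertex n m) C) := by
  refine ⟨fun n m _ _ => ⟨?_, fun H => isDiagonalSection_iff_exists_forest⟩,
    fun n m hn hm hnm => exists_isVirtualChamber_productVertex hn hm (by omega)⟩
  rw [chamberComplex_productVertex, diagonalSectionComplex_productVertex]
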